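/- Let $A\in\mathbb R^{n\times n}$, $B\in\mathbb R^{n\times m}$, $C\in\mathbb R^{m\times n}$ with $\operatorname{rank}B=\operatorname{rank}C=\operatorname{rank}(CB)=m$. Suppose that the square system $\dot x=Ax+Bu$, $y=Cx$ is of minimum phase, i.e. all its system zeros, the $s\in\mathbb C$ with $\det\begin{pmatrix} sI-A&-B\\ C&0\end{pmatrix}=0$, satisfy $\operatorname{Re}s<0$. Suppose that $CB$ is a Hurwitz H-matrix: all eigenvalues of $CB$ have negative real part, and all eigenvalues of its comparison matrix (with diagonal entries $|(CB)_{ii}|$ and off-diagonal entries $-|(CB)_{ij}|$) have positive real part. Call positive constants $\bar k_1,\dots,\bar k_m$ *sufficient* if the following holds: for all locally integrable $k_1,\dots,k_m:[0,\infty)\to\mathbb R$ for which there is a finite time $\bar t\ge0$ with $k_i(t)\ge\bar k_i$ for all $t\ge\bar t$ and all $i$, the closed loop $\dot x=(A+BK(t)C)x$ with $K(t)=\operatorname{diag}(k_1(t),\dots,k_m(t))$ is exponentially convergent, that is, there are $c,\beta>0$ such that for every $t_0\ge0$ every (Carathéodory) solution on $[t_0,\infty)$ satisfies $\|x(t)\|_2\le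 c\,e^{-\beta(t-t_0)}\|x(t_0)\|_2$ for all $t\ge t_0$. Then: 1. There exist sufficient positive constants $\bar k_1,\dots,\bar k_m$. 2. They can be chosen explicitly. There exist a matrix $M\in\mathbb R^{n\times(n-m)}$ of rank $n-m$ with $CM=0$, a positive diagonal matrix $D$ such that $\tilde B=(\tilde b_{ij}):=D\,CB\,D^{-1}$ is strictly column-diagonal dominant ($|\tilde b_{jj}|>\sum_{i\ne j}|\tilde b_{ij}|$ for all $j$), and constants $M_{11},\beta_{11}>0$ such that, with $N:=(M^TM)^{-1}M^T(I-B(CB)^{-1}C)$, $$\|e^{tNAM}\|_1\le M_{11}e^{-\beta_{11}t}\quad\text{for all }t\ge0,$$ where $\|\cdot\|_1$ is the matrix norm induced by the vector 1-norm (maximal column sum). For any such $M,D,M_{11},\beta_{11}$ put $\tilde A_{12}:=NAB(CB)^{-1}D^{-1}$, $\tilde A_{21}:=DCAM$, $(\tilde a_{ij}):=DCAB(CB)^{-1}D^{-1}$, $\gamma:=M_{11}\|\tilde A_{21}\|_1\|\tilde A_{12}\|_1/\beta_{11}$ and $$\tilde k_j:=\frac{\sum_{i\ne j}|\tilde a_{ij}|+\tilde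 a_{jj}+\gamma}{-\bigl(\tilde b_{jj}+\sum_{i\ne j}|\tilde b_{ij}|\bigr)},\qquad j=1,\dots,m.$$ Then all constants $\bar k_j$ with $\bar k_j>0$ and $\bar k_j>\tilde k_j$ for $j=1,\dots,m$ are sufficient. -/

import Mathlib

open MeasureTheory Set

/-- A real square matrix is Hurwitz if all its (complex) eigenvalues have negative real part. -/
def IsHurwitz {n : ℕ} (A : Matrix (Fin n) (Fin n) ℝ) : Prop :=
  ∀ s ∈ spectrum ℂ (A.map ((↑) : ℝ → ℂ)), s.re < 0

/-- An M-matrix: nonpositive off-diagonal entries, and all (complex) eigenvalues have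
positive real part. -/
def IsMMatrix {n : ℕ} (A : Matrix (Fin n) (Fin n) ℝ) : Prop :=
  (∀ i j, i ≠ j → A i j ≤ 0) ∧ ∀ s ∈ spectrum ℂ (A.map ((↑) : ℝ → ℂ)), 0 < s.re

/-- The comparison matrix: `|a i i|` on the diagonal and `-|a i j|` off the diagonal. -/
def comparisonMatrix {n : ℕ} (A : Matrix (Fin n) (Fin n) ℝ) : Matrix (Fin n) (Fin n) ℝ :=
  Matrix.of fun i j => if i = j then |A i j| else -|A i j|

/-- An H-matrix: its comparison matrix is an M-matrix. -/
def IsHMatrix {n : ℕ} (A : Matrix (Fin n) (Fin n) ℝ) : Prop :=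
  IsMMatrix (comparisonMatrix A)

/-- Strict column-diagonal dominance. -/
def IsColDiagDominant {n : ℕ} (A : Matrix (Fin n) (Fin n) ℝ) : Prop :=
  ∀ j, ∑ i ∈ Finset.univ.erase j, |A i j| < |A j j|

/-- The Rosenbrock system matrix of `x' = A x + B u`, `y = C x` at the complex number `s`. -/
noncomputable def rosenbrock {n m : ℕ} (A : Matrix (Fin n) (Fin n) ℝ)
    (B : Matrix (Fin n) (Fin m) ℝ) (C : Matrix (Fin m) (Fin n) ℝ) (s : ℂ) :
    Matrix (Fin n ⊕ Fin m) (Fin n ⊕ Fin m) ℂ :=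
  Matrix.fromBlocks (s • (1 : Matrix (Fin n) (Fin n) ℂ) - A.map ((↑) : ℝ → ℂ))
    (-B.map ((↑) : ℝ → ℂ)) (C.map ((↑) : ℝ → ℂ)) 0

/-- The zeros of a square system: the points where its system matrix loses rank. (When `C * B` is
nonsingular, the determinant of the system matrix is a nonzero polynomial in `s`,
so the normal rank is full.) -/
def IsSystemZero {n m : ℕ} (A : Matrix (Fin n) (Fin n) ℝ)
    (B : Matrix (Fin n) (Fin m) ℝ) (C : Matrix (Fin m) (Fin n) ℝ) (s : ℂ) : Prop :=
  (rosenbrock A B C s).det = 0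

/-- Minimum phase: all system zeros lie in the open left half plane. -/
def IsMinimumPhase {n m : ℕ} (A : Matrix (Fin n) (Fin n) ℝ)
    (B : Matrix (Fin n) (Fin m) ℝ) (C : Matrix (Fin m) (Fin n) ℝ) : Prop :=
  ∀ s : ℂ, IsSystemZero A B C s → s.re < 0

/-- `x` is a (Carathéodory) solution of `x' = F(t) x` on `[t₀, ∞)`: it is continuous there and
satisfies the integral form of the equation. For continuous `F` this is the classical notion. -/
def IsSolutionFrom {n : ℕ} (F : ℝ → Matrix (Fin n) (Fin n) ℝ) (t₀ : ℝ)
    (x : ℝ → Fin n → ℝ) : Prop :=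
  ContinuousOn x (Ici t₀) ∧
    ∀ t, t₀ ≤ t → x t = x t₀ + ∫ s in t₀..t, (F s).mulVec (x s)

/-- Exponential convergence of `x' = F(t) x`, `t ≥ 0`, in the Euclidean norm: all solutions, from
all initial times and states, obey one common exponential estimate. -/
def IsExpConvergent {n : ℕ} (F : ℝ → Matrix (Fin n) (Fin n) ℝ) : Prop :=
  ∃ c β : ℝ, 0 < c ∧ 0 < β ∧ ∀ t₀, 0 ≤ t₀ → ∀ x : ℝ → Fin n → ℝ, IsSolutionFrom F t₀ x →
    ∀ t, t₀ ≤ t →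
      ‖WithLp.toLp 2 (x t)‖ ≤ c * Real.exp (-β * (t - t₀)) * ‖WithLp.toLp 2 (x t₀)‖

/-- The closed-loop matrix `A + B K(t) C` with the diagonal gain `K(t) = diag (k i t)`. -/
def closedLoop {n m : ℕ} (A : Matrix (Fin n) (Fin n) ℝ)
    (B : Matrix (Fin n) (Fin m) ℝ) (C : Matrix (Fin m) (Fin n) ℝ) (k : Fin m → ℝ → ℝ) (t : ℝ) :
    Matrix (Fin n) (Fin n) ℝ :=
  A + B * Matrix.diagonal (fun i => k i t) * C

/-- The constants `kbar i` suffice for stabilization: whenever the (locally integrable) gains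
satisfy `k i t ≥ kbar i` from some finite time `tbar` on, the closed loop is exponentially
convergent. -/
def GainsSuffice {n m : ℕ} (A : Matrix (Fin n) (Fin n) ℝ)
    (B : Matrix (Fin n) (Fin m) ℝ) (C : Matrix (Fin m) (Fin n) ℝ) (kbar : Fin m → ℝ) : Prop :=
  ∀ k : Fin m → ℝ → ℝ, (∀ i, LocallyIntegrableOn (k i) (Ici 0)) →
    ∀ tbar : ℝ, 0 ≤ tbar → (∀ i, ∀ t, tbar ≤ t → kbar i ≤ k i t) →
      IsExpConvergent (closedLoop A B C k)

/-- The matrix norm induced by the vector 1-norm (the maximal column sum; `0` for a matrix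
without columns). -/
noncomputable def colSumNorm {p q : ℕ} (A : Matrix (Fin p) (Fin q) ℝ) : ℝ :=
  ⨆ j, ∑ i, |A i j|

section NormalForm

variable {n m : ℕ} (A : Matrix (Fin n) (Fin n) ℝ) (B : Matrix (Fin n) (Fin m) ℝ)
  (C : Matrix (Fin m) (Fin n) ℝ) (M : Matrix (Fin n) (Fin (n - m)) ℝ) (d : Fin m → ℝ)

/-- `N = (Mᵀ M)⁻¹ Mᵀ (I - B (C B)⁻¹ C)`. -/
noncomputable def matN : Matrix (Fin (n - m)) (Fin n) ℝ :=
  (M.transpose * M)⁻¹ * M.transpose * (1 - B * (C * B)⁻¹ * C)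

/-- The block `N A M`, the matrix of the zero dynamics. -/
noncomputable def blockA11 : Matrix (Fin (n - m)) (Fin (n - m)) ℝ := matN B C M * A * M

/-- The block `N A B (C B)⁻¹ D⁻¹` with `D = diag d`. -/
noncomputable def tildeA12 : Matrix (Fin (n - m)) (Fin m) ℝ :=
  matN B C M * A * B * (C * B)⁻¹ * (Matrix.diagonal d)⁻¹

/-- The block `D C A M`. -/
noncomputable def tildeA21 : Matrix (Fin m) (Fin (n - m)) ℝ := Matrix.diagonal d * C * A * M

/-- The block `D C A B (C B)⁻¹ D⁻¹`. -/
noncomputable def tildeA22 : Matrix (Fin m) (Fin m) ℝ :=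
  Matrix.diagonal d * C * A * B * (C * B)⁻¹ * (Matrix.diagonal d)⁻¹

/-- The scaled matrix `D C B D⁻¹`. -/
noncomputable def tildeB : Matrix (Fin m) (Fin m) ℝ :=
  Matrix.diagonal d * (C * B) * (Matrix.diagonal d)⁻¹

/-- Admissible data for the explicit gain bound: the columns of `M` form a basis of `ker C`, the
positive diagonal matrix `diag d` makes `D C B D⁻¹` strictly column-diagonal dominant, and
`‖exp (t N A M)‖₁ ≤ M₁₁ exp (-β₁₁ t)` for all `t ≥ 0`. -/
structure IsBoundData (M₁₁ β₁₁ : ℝ) : Prop where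
  mul_eq_zero : C * M = 0
  rank_eq : M.rank = n - m
  d_pos : ∀ j, 0 < d j
  dominant : IsColDiagDominant (tildeB B C d)
  M₁₁_pos : 0 < M₁₁
  β₁₁_pos : 0 < β₁₁
  exp_le : ∀ t : ℝ, 0 ≤ t →
    colSumNorm (NormedSpace.exp (t • blockA11 A B C M)) ≤ M₁₁ * Real.exp (-β₁₁ * t)

/-- `γ = M₁₁ ‖Ã₂₁‖₁ ‖Ã₁₂‖₁ / β₁₁`. -/
noncomputable def gammaBound (M₁₁ β₁₁ : ℝ) : ℝ :=
  M₁₁ * colSumNorm (tildeA21 A C M d) * colSumNorm (tildeA12 A B C M d) / β₁₁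

/-- The explicit lower bound for the `j`-th gain:
`(∑_{i ≠ j} |ã i j| + ã j j + γ) / (-(b̃ j j + ∑_{i ≠ j} |b̃ i j|))`. -/
noncomputable def gainThreshold (M₁₁ β₁₁ : ℝ) (j : Fin m) : ℝ :=
  (∑ i ∈ Finset.univ.erase j, |tildeA22 A B C d i j| + tildeA22 A B C d j j
      + gammaBound A B C M d M₁₁ β₁₁) /
    (-(tildeB B C d j j + ∑ i ∈ Finset.univ.erase j, |tildeB B C d i j|))

end NormalForm

/-!
In the coordinates `z = N x`, `y = D C x` the closed loop reads
`z' = A₁₁ z + A₁₂ y`, `y' = A₂₁ z + A₂₂ y + D C B D⁻¹ K(t) y`, because `N B = 0` and the diagonal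
matrices `D` and `K(t)` commute (`matN_mul_closedLoop`, `scaledOutput_mul_closedLoop`). The matrix
`A₁₁ = N A M` is Hurwitz because its eigenvalues are system zeros
(`IsMinimumPhase.isHurwitz_blockA11`). The scaled matrix `D C B D⁻¹` is column dominant with
negative diagonal, so a large gain `k j` pushes the `j`-th column of the `y`-equation below any
prescribed negative bound, however irregularly the gains vary above their lower bounds.

Stability is a small-gain argument in the 1-norm. Variation of constants majorizes `‖z‖₁` by a
scalar function `U` with `U' = -β U + M₁₁ ‖A₁₂‖₁ ‖y‖₁`. The function `V = ‖y‖₁ + μ U` with `μ`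
slightly above `‖A₂₁‖₁ / β` then satisfies `V' ≤ ρ V` almost everywhere, where `ρ` is a negative
constant after the time from which the gains are large, and integrable before
(`sum_abs_add_mul_sum_abs_le`). Grönwall's inequality for absolutely continuous functions
(`AbsolutelyContinuousOnInterval.le_exp_integral_mul`) gives the exponential estimate; the finite
initial phase only contributes a constant factor, uniform in the initial time.

All facts on Hurwitz matrices come from one observation: if `X` is Hurwitz, the powers of
`1 + h X` decay geometrically for small `h > 0` (`IsHurwitz.eventually_abs_pow_le`, from Gelfand's
formula). This yields the decay of `exp (t X)` (`IsHurwitz.exists_abs_exp_le`), the positive weights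
`d` that make an H-matrix column dominant (`IsMMatrix.exists_pos_vecMul_pos`), and the negativity of
the diagonal of a column-dominant Hurwitz matrix (`IsHurwitz.diag_neg_of_isColDiagDominant`).
-/

open Filter Topology

/-! ### Powers and exponentials of Hurwitz matrices -/

section Powers

open scoped Matrix.Norms.Operator Pointwise

/-- Gelfand's formula in the form of a geometric bound on the powers. -/
theorem exists_norm_pow_le_of_spectralRadius_lt_one {𝔸 : Type*} [NormedRing 𝔸] [NormedAlgebra ℂ 𝔸]
    [CompleteSpace 𝔸] {a : 𝔸} (ha : spectralRadius ℂ a < 1) :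
    ∃ K r : ℝ, 0 < K ∧ 0 < r ∧ r < 1 ∧ ∀ k : ℕ, ‖a ^ k‖ ≤ K * r ^ k := by
  obtain ⟨r, hr, hr1⟩ := ENNReal.lt_iff_exists_nnreal_btwn.1 ha
  have hr1' : (r : ℝ) < 1 := by exact_mod_cast hr1
  have hr0 : (0 : ℝ) < r := by
    have : (0 : ENNReal) < r := lt_of_le_of_lt zero_le hr
    exact_mod_cast this
  have hev := (spectrum.pow_nnnorm_pow_one_div_tendsto_nhds_spectralRadius a).eventually
    (gt_mem_nhds hr)
  have hO : (fun k : ℕ => a ^ k) =O[atTop] fun k : ℕ => (r : ℝ) ^ k := by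
    refine Asymptotics.IsBigO.of_bound 1 ?_
    filter_upwards [hev, eventually_gt_atTop 0] with k hk hk0
    have hk' : (k : ℝ) ≠ 0 := by positivity
    have h1 : (‖a ^ k‖₊ : ENNReal) ≤ (r : ENNReal) ^ k := by
      have h2 := ENNReal.rpow_le_rpow hk.le (Nat.cast_nonneg (α := ℝ) k)
      rwa [← ENNReal.rpow_mul, one_div, inv_mul_cancel₀ hk', ENNReal.rpow_one,
        ENNReal.rpow_natCast] at h2
    have h3 : ‖a ^ k‖ ≤ (r : ℝ) ^ k := by exact_mod_cast h1
    simpa [abs_of_pos hr0] using h3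
  obtain ⟨K, hK, hb⟩ := Asymptotics.bound_of_isBigO_nat_atTop hO
  refine ⟨K, r, hK, hr0, hr1', fun k => ?_⟩
  simpa [abs_of_pos hr0] using hb (pow_ne_zero k hr0.ne')

theorem Matrix.norm_entry_le_linfty_opNorm {n : ℕ} (A : Matrix (Fin n) (Fin n) ℂ) (i j : Fin n) :
    ‖A i j‖ ≤ ‖A‖ := by
  have h1 : ‖A i j‖₊ ≤ ‖A‖₊ := by
    rw [Matrix.linfty_opNNNorm_def]
    exact (Finset.single_le_sum (f := fun j => ‖A i j‖₊) (fun _ _ => zero_le)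
      (Finset.mem_univ j)).trans
      (Finset.le_sup (f := fun i => ∑ j, ‖A i j‖₊) (Finset.mem_univ i))
  exact_mod_cast h1

/-- For a Hurwitz matrix `A` and all sufficiently small step sizes `h > 0`, the Euler matrix
`1 + h A` has spectral radius less than one, so its powers decay geometrically. -/
theorem IsHurwitz.eventually_abs_pow_le {n : ℕ} {A : Matrix (Fin n) (Fin n) ℝ}
    (hA : IsHurwitz A) :
    ∀ᶠ h : ℝ in 𝓝[>] 0, ∃ K r : ℝ, 0 < K ∧ 0 < r ∧ r < 1 ∧
      ∀ (k : ℕ) (i j : Fin n), |((1 + h • A) ^ k) i j| ≤ K * r ^ k := by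
  rcases Nat.eq_zero_or_pos n with rfl | hn
  · exact Eventually.of_forall fun h => ⟨1, 1 / 2, by norm_num, by norm_num, by norm_num,
      fun k i => i.elim0⟩
  have : Nonempty (Fin n) := ⟨⟨0, hn⟩⟩
  set Ac : Matrix (Fin n) (Fin n) ℂ := A.map ((↑) : ℝ → ℂ) with hAc
  have hfin : (spectrum ℂ Ac).Finite := Matrix.finite_spectrum Ac
  have hsmall : ∀ᶠ h : ℝ in 𝓝[>] 0, ∀ s ∈ spectrum ℂ Ac, ‖1 + (h : ℂ) * s‖ < 1 := by
    rw [hfin.eventually_all]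
    intro s hs
    have hre := hA s hs
    have hlim : Tendsto (fun h : ℝ => h * Complex.normSq s) (𝓝[>] 0) (𝓝 0) := by
      have : Tendsto (fun h : ℝ => h * Complex.normSq s) (𝓝 0) (𝓝 (0 * Complex.normSq s)) :=
        (continuous_id.mul continuous_const).tendsto 0
      rw [zero_mul] at this
      exact this.mono_left nhdsWithin_le_nhds
    filter_upwards [hlim.eventually (gt_mem_nhds (show (0 : ℝ) < -2 * s.re by linarith)),
      self_mem_nhdsWithin] with h hh hpos
    have hpos : 0 < h := hpos
    have h1 : Complex.normSq (1 + (h : ℂ) * s) < 1 := by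
      rw [Complex.normSq_apply] at hh ⊢
      simp only [Complex.add_re, Complex.one_re, Complex.mul_re, Complex.ofReal_re,
        Complex.ofReal_im, Complex.add_im, Complex.one_im, Complex.mul_im]
      nlinarith
    rw [Complex.normSq_eq_norm_sq] at h1
    nlinarith [norm_nonneg (1 + (h : ℂ) * s)]
  filter_upwards [hsmall, self_mem_nhdsWithin] with h hh hpos
  have hpos : 0 < h := hpos
  have hrad : spectralRadius ℂ (1 + (h : ℂ) • Ac) < 1 := by
    have key : ∀ z ∈ spectrum ℂ (1 + (h : ℂ) • Ac), ‖z‖₊ < 1 := by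
      intro z hz
      have h0 : (h : ℂ) ≠ 0 := by exact_mod_cast hpos.ne'
      have h2 := spectrum.singleton_add_eq ((h : ℂ) • Ac) (1 : ℂ)
      rw [map_one] at h2
      rw [← h2] at hz
      have h3 : spectrum ℂ ((h : ℂ) • Ac) = (h : ℂ) • spectrum ℂ Ac :=
        spectrum.unit_smul_eq_smul Ac (Units.mk0 (h : ℂ) h0)
      rw [h3] at hz
      obtain ⟨_, rfl, y, ⟨s, hs, rfl⟩, rfl⟩ := hz
      have := hh s hs
      exact_mod_cast this
    exact_mod_cast spectrum.spectralRadius_lt_of_forall_lt (r := 1) _ key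
  obtain ⟨K, r, hK, hr0, hr1, hb⟩ := exists_norm_pow_le_of_spectralRadius_lt_one hrad
  refine ⟨K, r, hK, hr0, hr1, fun k i j => ?_⟩
  have hmap : (1 + (h : ℂ) • Ac) ^ k = ((1 + h • A) ^ k).map ((↑) : ℝ → ℂ) := by
    have h4 : Complex.ofRealHom.mapMatrix (1 + h • A) = 1 + (h : ℂ) • Ac := by
      rw [map_add, map_one]
      congr 1
      ext i j
      simp [hAc]
    rw [← h4, ← map_pow]
    rfl
  have h5 := (Matrix.norm_entry_le_linfty_opNorm _ i j).trans (hb k)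
  rw [hmap] at h5
  simpa using h5

/-- With `P = 1 + h A` one has `exp (t A) = e ^ (-t / h) exp ((t / h) P)`, so the geometric decay
of the powers of `P` gives the exponential decay of `exp (t A)`. -/
theorem IsHurwitz.exists_abs_exp_le {n : ℕ} {A : Matrix (Fin n) (Fin n) ℝ} (hA : IsHurwitz A) :
    ∃ K β : ℝ, 0 < K ∧ 0 < β ∧ ∀ t : ℝ, 0 ≤ t → ∀ i j,
      |NormedSpace.exp (t • A) i j| ≤ K * Real.exp (-β * t) := by
  obtain ⟨h, ⟨K, r, hK, hr0, hr1, hb⟩, hpos⟩ :=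
    (hA.eventually_abs_pow_le.and self_mem_nhdsWithin).exists
  have hpos : 0 < h := hpos
  refine ⟨K, (1 - r) / h, hK, div_pos (by linarith) hpos, fun t ht i j => ?_⟩
  set P := 1 + h • A with hP
  set τ := t / h with hτ
  have hτ0 : 0 ≤ τ := div_nonneg ht hpos.le
  have hsplit : t • A = (-τ) • (1 : Matrix (Fin n) (Fin n) ℝ) + τ • P := by
    rw [hP, smul_add, smul_smul, hτ, div_mul_cancel₀ _ hpos.ne', ← add_assoc, ← add_smul]
    simp
  have hexp : NormedSpace.exp (t • A) = Real.exp (-τ) • NormedSpace.exp (τ • P) := by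
    have hc : Commute ((-τ) • (1 : Matrix (Fin n) (Fin n) ℝ)) (τ • P) :=
      (Commute.one_left (τ • P)).smul_left (-τ)
    rw [hsplit, Matrix.exp_add_of_commute _ _ hc]
    have h1 : (-τ) • (1 : Matrix (Fin n) (Fin n) ℝ) = Matrix.diagonal fun _ => -τ := by
      rw [Matrix.smul_one_eq_diagonal]
    have h2 : NormedSpace.exp ((-τ) • (1 : Matrix (Fin n) (Fin n) ℝ)) =
        Real.exp (-τ) • (1 : Matrix (Fin n) (Fin n) ℝ) := by
      rw [h1, Matrix.exp_diagonal, Matrix.smul_one_eq_diagonal]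
      congr 1
      ext i
      rw [Pi.coe_exp, Real.exp_eq_exp_ℝ]
    rw [h2, smul_mul_assoc, one_mul]
  have hsum : HasSum (fun k : ℕ => ((k.factorial : ℝ)⁻¹ • (τ • P) ^ k) i j)
      (NormedSpace.exp (τ • P) i j) :=
    Pi.hasSum.1 (Pi.hasSum.1 (NormedSpace.exp_series_hasSum_exp' (𝕂 := ℝ) (τ • P)) i) j
  have hreal : HasSum (fun k : ℕ => K * ((k.factorial : ℝ)⁻¹ * (τ * r) ^ k))
      (K * Real.exp (τ * r)) := by
    have := NormedSpace.exp_series_hasSum_exp' (𝕂 := ℝ) (τ * r)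
    rw [← Real.exp_eq_exp_ℝ] at this
    simpa using this.mul_left K
  have hbd : ‖NormedSpace.exp (τ • P) i j‖ ≤ K * Real.exp (τ * r) := by
    rw [← hsum.tsum_eq]
    refine tsum_of_norm_bounded hreal fun k => ?_
    rw [smul_pow, Matrix.smul_apply, Matrix.smul_apply, smul_eq_mul, smul_eq_mul, norm_mul,
      norm_mul, Real.norm_eq_abs, Real.norm_eq_abs, Real.norm_eq_abs,
      abs_of_nonneg (by positivity : (0 : ℝ) ≤ (k.factorial : ℝ)⁻¹),
      abs_of_nonneg (by positivity : (0 : ℝ) ≤ τ ^ k), mul_pow]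
    have := mul_le_mul_of_nonneg_left (hb k i j)
      (by positivity : (0 : ℝ) ≤ (k.factorial : ℝ)⁻¹ * τ ^ k)
    linarith
  rw [hexp, Matrix.smul_apply, smul_eq_mul, abs_mul, abs_of_pos (Real.exp_pos _)]
  calc Real.exp (-τ) * |NormedSpace.exp (τ • P) i j|
      ≤ Real.exp (-τ) * (K * Real.exp (τ * r)) :=
        mul_le_mul_of_nonneg_left hbd (Real.exp_pos _).le
    _ = K * (Real.exp (-τ) * Real.exp (τ * r)) := by ring
    _ = K * Real.exp (-((1 - r) / h) * t) := by
        rw [← Real.exp_add]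
        congr 2
        rw [hτ]
        ring

theorem eventually_forall_mul_le_one {ι : Type*} [Finite ι] (c : ι → ℝ) :
    ∀ᶠ h : ℝ in 𝓝[>] 0, ∀ i, h * c i ≤ 1 := by
  rw [eventually_all]
  intro i
  have hlim : Tendsto (fun h : ℝ => h * c i) (𝓝 0) (𝓝 (0 * c i)) :=
    (continuous_id.mul continuous_const).tendsto 0
  rw [zero_mul] at hlim
  filter_upwards [(hlim.mono_left nhdsWithin_le_nhds).eventually
    (gt_mem_nhds (zero_lt_one' ℝ))] with h hh using hh.le

theorem tendsto_const_mul_geometric (c C : ℝ) {r : ℝ} (hr0 : 0 ≤ r) (hr1 : r < 1) :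
    Tendsto (fun k : ℕ => c * (C * r ^ k)) atTop (𝓝 0) := by
  simpa using ((tendsto_pow_atTop_nhds_zero_of_lt_one hr0 hr1).const_mul C).const_mul c

/-! ### M-matrices and diagonally dominant Hurwitz matrices -/

/-- A nonsingular M-matrix `G` admits positive weights `d` with `dᵀ G > 0`. For small `h > 0` the
matrix `P = 1 - h G` is nonnegative with decaying powers, and `dᵀ = 1ᵀ ∑_{k < K} P ^ k` satisfies
`h dᵀ G = 1ᵀ (1 - P ^ K)`, which is positive for large `K`. -/
theorem IsMMatrix.exists_pos_vecMul_pos {n : ℕ} {G : Matrix (Fin n) (Fin n) ℝ}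
    (hG : IsMMatrix G) :
    ∃ d : Fin n → ℝ, (∀ i, 0 < d i) ∧ ∀ j, 0 < ∑ i, d i * G i j := by
  have hneg : IsHurwitz (-G) := by
    intro s hs
    have h1 : (-G).map ((↑) : ℝ → ℂ) = -(G.map ((↑) : ℝ → ℂ)) := by
      ext i j
      simp
    rw [h1, ← spectrum.neg_eq] at hs
    have := hG.2 (-s) hs
    simpa using this
  have hdiag := eventually_forall_mul_le_one fun i => G i i
  obtain ⟨h, ⟨⟨C, r, hC, hr0, hr1, hb⟩, hd⟩, hpos⟩ :=
    ((hneg.eventually_abs_pow_le.and hdiag).and self_mem_nhdsWithin).exists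
  have hpos : 0 < h := hpos
  set P := 1 + h • -G with hP
  have hP0 : ∀ i j, 0 ≤ P i j := by
    intro i j
    by_cases hij : i = j
    · subst hij
      simp only [hP, Matrix.add_apply, Matrix.one_apply_eq, Matrix.smul_apply, Matrix.neg_apply,
        smul_eq_mul]
      linarith [hd i]
    · simp only [hP, Matrix.add_apply, Matrix.one_apply_ne hij, Matrix.smul_apply,
        Matrix.neg_apply, smul_eq_mul]
      nlinarith [hG.1 i j hij]
  have hPk : ∀ (k : ℕ) (i j), 0 ≤ (P ^ k) i j := by
    intro k
    induction k with
    | zero =>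
      intro i j
      rw [pow_zero, Matrix.one_apply]
      split_ifs <;> norm_num
    | succ k ih =>
      intro i j
      rw [pow_succ, Matrix.mul_apply]
      exact Finset.sum_nonneg fun l _ => mul_nonneg (ih i l) (hP0 l j)
  obtain ⟨K, hK, hK0⟩ := (((tendsto_const_mul_geometric n C hr0.le hr1).eventually
    (gt_mem_nhds (zero_lt_one' ℝ))).and
    (eventually_gt_atTop 0)).exists
  set S := ∑ k ∈ Finset.range K, P ^ k with hS
  have hSG : S * (h • G) = 1 - P ^ K := by
    have h1 : h • G = 1 - P := by
      rw [hP]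
      simp
    rw [h1, hS, geom_sum_mul_neg]
  refine ⟨fun i => ∑ l, S l i, fun i => ?_, fun j => ?_⟩
  · have hSli : ∀ l, (P ^ 0) l i ≤ S l i := by
      intro l
      rw [hS, Matrix.sum_apply]
      exact Finset.single_le_sum (f := fun k => (P ^ k) l i) (fun k _ => hPk k l i)
        (Finset.mem_range.2 hK0)
    calc (0 : ℝ) < ∑ l, (P ^ 0) l i := by simp [Matrix.one_apply]
      _ ≤ _ := Finset.sum_le_sum fun l _ => hSli l
  · have h2 : h * ∑ i, (∑ l, S l i) * G i j = ∑ l, (S * (h • G)) l j := by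
      simp_rw [Matrix.mul_apply, Finset.sum_mul, Finset.mul_sum]
      rw [Finset.sum_comm]
      refine Finset.sum_congr rfl fun l _ => Finset.sum_congr rfl fun i _ => ?_
      simp only [Matrix.smul_apply, smul_eq_mul]
      ring
    have h3 : ∑ l, (P ^ K) l j < 1 := by
      refine lt_of_le_of_lt ?_ hK
      calc ∑ l, (P ^ K) l j ≤ ∑ _l : Fin n, C * r ^ K :=
            Finset.sum_le_sum fun l _ => (le_abs_self _).trans (hb K l j)
        _ = _ := by simp
    have h4 : ∑ l, (S * (h • G)) l j = 1 - ∑ l, (P ^ K) l j := by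
      rw [hSG]
      simp [Finset.sum_sub_distrib, Matrix.one_apply]
    rw [h4] at h2
    refine pos_of_mul_pos_right (a := h) ?_ hpos.le
    rw [h2]
    linarith

/-- A strictly column-diagonally dominant Hurwitz matrix has a negative diagonal. With
`σ i = 1` where `0 < B i i` and `σ i = -1` elsewhere, `V y = ∑ σ i |y i|` does not decrease along
the iteration of `1 + h B`; started at a unit vector `e j` with `σ j = 1` this contradicts the decay
of the powers of `1 + h B`. -/
theorem IsHurwitz.diag_neg_of_isColDiagDominant {n : ℕ} {B : Matrix (Fin n) (Fin n) ℝ}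
    (hB : IsHurwitz B) (hdom : IsColDiagDominant B) (j : Fin n) : B j j < 0 := by
  by_contra hj
  have hjpos : 0 < B j j := by
    have h1 : 0 < |B j j| := lt_of_le_of_lt (Finset.sum_nonneg fun _ _ => abs_nonneg _) (hdom j)
    exact lt_of_le_of_ne (not_lt.1 hj) (abs_pos.1 h1).symm
  have hdiag := eventually_forall_mul_le_one fun i => |B i i|
  obtain ⟨h, ⟨⟨C, r, hC, hr0, hr1, hb⟩, hd⟩, hpos⟩ :=
    ((hB.eventually_abs_pow_le.and hdiag).and self_mem_nhdsWithin).exists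
  have hpos : 0 < h := hpos
  set P := 1 + h • B with hP
  let σ : Fin n → ℝ := fun i => if 0 < B i i then 1 else -1
  have hσB : ∀ i, σ i * B i i = |B i i| := by
    intro i
    by_cases h0 : 0 < B i i
    · simp [σ, h0, abs_of_pos h0]
    · simp [σ, h0, abs_of_nonpos (not_lt.1 h0)]
  have hσ : ∀ i, σ i = 1 ∨ σ i = -1 := by
    intro i
    by_cases h0 : 0 < B i i <;> simp [σ, h0]
  have hstep : ∀ y : Fin n → ℝ, ∑ i, σ i * |y i| ≤ ∑ i, σ i * |P.mulVec y i| := by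
    intro y
    have hi : ∀ i, σ i * |y i| + h * (|B i i| * |y i|)
        - h * ∑ l ∈ Finset.univ.erase i, |B i l| * |y l| ≤ σ i * |P.mulVec y i| := by
      intro i
      set R := ∑ l ∈ Finset.univ.erase i, B i l * y l with hR
      have hPy : P.mulVec y i = (1 + h * B i i) * y i + h * R := by
        have h1 : B.mulVec y i = B i i * y i + R := by
          exact (Finset.add_sum_erase _ (fun l => B i l * y l) (Finset.mem_univ i)).symm
        rw [hP, Matrix.add_mulVec, Matrix.one_mulVec, Matrix.smul_mulVec, Pi.add_apply,
          Pi.smul_apply, h1, smul_eq_mul]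
        ring
      have hRle : |R| ≤ ∑ l ∈ Finset.univ.erase i, |B i l| * |y l| := by
        refine (Finset.abs_sum_le_sum_abs _ _).trans (le_of_eq ?_)
        simp_rw [abs_mul]
      have hpos1 : 0 ≤ 1 + h * B i i := by
        have := neg_abs_le (B i i)
        nlinarith [hd i]
      have hy : |(1 + h * B i i) * y i| = (1 + h * B i i) * |y i| := by
        rw [abs_mul, abs_of_nonneg hpos1]
      have hhR : |h * R| ≤ h * ∑ l ∈ Finset.univ.erase i, |B i l| * |y l| := by
        rw [abs_mul, abs_of_pos hpos]
        exact mul_le_mul_of_nonneg_left hRle hpos.le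
      have hup := abs_add_le ((1 + h * B i i) * y i) (h * R)
      have hlo := abs_sub_abs_le_abs_add ((1 + h * B i i) * y i) (h * R)
      rw [hPy, ← hσB i]
      rcases hσ i with h1 | h1 <;> rw [h1] <;> linarith
    refine le_trans ?_ (Finset.sum_le_sum fun i _ => hi i)
    rw [Finset.sum_sub_distrib, Finset.sum_add_distrib, ← Finset.mul_sum, ← Finset.mul_sum]
    have hswap : ∑ i, ∑ l ∈ Finset.univ.erase i, |B i l| * |y l| =
        ∑ l, (∑ i ∈ Finset.univ.erase l, |B i l|) * |y l| := by
      simp_rw [Finset.sum_mul]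
      refine Finset.sum_comm' ?_
      intro i l
      simp [eq_comm]
    have hle : ∑ i, ∑ l ∈ Finset.univ.erase i, |B i l| * |y l| ≤ ∑ i, |B i i| * |y i| := by
      rw [hswap]
      exact Finset.sum_le_sum fun l _ =>
        mul_le_mul_of_nonneg_right (hdom l).le (abs_nonneg _)
    have := mul_le_mul_of_nonneg_left hle hpos.le
    linarith
  have hV : ∀ k : ℕ, 1 ≤ ∑ i, σ i * |(P ^ k) i j| := by
    intro k
    induction k with
    | zero =>
      have hσj : σ j = 1 := by simp [σ, hjpos]
      rw [Finset.sum_eq_single j]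
      · simp [hσj]
      · intro i _ hij
        simp [Matrix.one_apply_ne hij]
      · simp
    | succ k ih =>
      refine ih.trans ((hstep fun i => (P ^ k) i j).trans (le_of_eq ?_))
      rw [pow_succ']
      rfl
  obtain ⟨k, hk⟩ := ((tendsto_const_mul_geometric n C hr0.le hr1).eventually
    (gt_mem_nhds (zero_lt_one' ℝ))).exists
  have h5 : ∑ i, σ i * |(P ^ k) i j| ≤ ∑ _i : Fin n, C * r ^ k := by
    refine Finset.sum_le_sum fun i _ => le_trans ?_ (hb k i j)
    rcases hσ i with h1 | h1 <;> rw [h1] <;> linarith [abs_nonneg ((P ^ k) i j)]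
  have h6 := hV k
  simp only [Finset.sum_const, Finset.card_univ, Fintype.card_fin, nsmul_eq_mul] at h5
  linarith

end Powers

/-! ### The normal form and the zero dynamics -/

theorem Matrix.isUnit_det_of_rank_eq {k : ℕ} {A : Matrix (Fin k) (Fin k) ℝ} (hA : A.rank = k) :
    IsUnit A.det := by
  rw [isUnit_iff_ne_zero]
  intro h0
  obtain ⟨v, hv, hAv⟩ := Matrix.exists_mulVec_eq_zero_iff.2 h0
  have hker : LinearMap.ker A.mulVecLin = ⊥ := by
    have h1 := LinearMap.finrank_range_add_finrank_ker A.mulVecLin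
    have h2 : Module.finrank ℝ (LinearMap.range A.mulVecLin) = k := hA
    rw [h2, Module.finrank_fin_fun] at h1
    exact Submodule.finrank_eq_zero.1 (by omega)
  have hmem : v ∈ LinearMap.ker A.mulVecLin := by simpa using hAv
  rw [hker] at hmem
  exact hv (by simpa using hmem)

/-- A matrix of full row rank has a matrix whose columns form a basis of its kernel. -/
theorem Matrix.exists_mul_eq_zero_and_rank_eq {n m : ℕ} (C : Matrix (Fin m) (Fin n) ℝ)
    (hC : C.rank = m) :
    ∃ M : Matrix (Fin n) (Fin (n - m)) ℝ, C * M = 0 ∧ M.rank = n - m := by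
  have hfin : Module.finrank ℝ (LinearMap.ker C.mulVecLin) = n - m := by
    have h1 := LinearMap.finrank_range_add_finrank_ker C.mulVecLin
    have h2 : Module.finrank ℝ (LinearMap.range C.mulVecLin) = m := hC
    rw [h2, Module.finrank_fin_fun] at h1
    omega
  let b := Module.finBasisOfFinrankEq ℝ (LinearMap.ker C.mulVecLin) hfin
  let R : Matrix (Fin (n - m)) (Fin n) ℝ := Matrix.of fun j => (b j : Fin n → ℝ)
  have hR : R.rank = n - m := by
    have h3 : LinearIndependent ℝ R.row :=
      b.linearIndependent.map' (Submodule.subtype _) (Submodule.ker_subtype _)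
    simpa using h3.rank_matrix
  refine ⟨R.transpose, ?_, by rw [Matrix.rank_transpose, hR]⟩
  ext i j
  have h4 : C.mulVec (b j : Fin n → ℝ) = 0 := (b j).2
  exact congrFun h4 i

theorem IsHurwitz.of_charpoly_eq {n : ℕ} {A B : Matrix (Fin n) (Fin n) ℝ} (hA : IsHurwitz A)
    (h : B.charpoly = A.charpoly) : IsHurwitz B := by
  intro s hs
  refine hA s ?_
  have hmap : ∀ X : Matrix (Fin n) (Fin n) ℝ,
      (X.map ((↑) : ℝ → ℂ)).charpoly = X.charpoly.map Complex.ofRealHom := fun X =>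
    Matrix.charpoly_map X Complex.ofRealHom
  rw [Matrix.mem_spectrum_iff_isRoot_charpoly, hmap] at hs ⊢
  rwa [← h]

section NormalForm

variable {n m : ℕ} {A : Matrix (Fin n) (Fin n) ℝ} {B : Matrix (Fin n) (Fin m) ℝ}
  {C : Matrix (Fin m) (Fin n) ℝ} {M : Matrix (Fin n) (Fin (n - m)) ℝ} {d : Fin m → ℝ}

theorem matN_mul_self (hM : M.rank = n - m) (hCM : C * M = 0) : matN B C M * M = 1 := by
  have hu : IsUnit (M.transpose * M).det :=
    Matrix.isUnit_det_of_rank_eq (by rw [Matrix.rank_transpose_mul_self, hM])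
  have h1 : (1 - B * (C * B)⁻¹ * C) * M = M := by
    rw [Matrix.sub_mul, Matrix.one_mul, Matrix.mul_assoc _ C M, hCM, Matrix.mul_zero, sub_zero]
  rw [matN, Matrix.mul_assoc, h1, Matrix.mul_assoc, Matrix.nonsing_inv_mul _ hu]

theorem matN_mul_input (hCB : IsUnit (C * B).det) : matN B C M * B = 0 := by
  have h1 : (1 - B * (C * B)⁻¹ * C) * B = 0 := by
    rw [Matrix.sub_mul, Matrix.one_mul, Matrix.mul_assoc _ C B, Matrix.mul_assoc B,
      Matrix.nonsing_inv_mul _ hCB, Matrix.mul_one, sub_self]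
  rw [matN, Matrix.mul_assoc, h1, Matrix.mul_zero]

/-- The matrices `[M, B (C B)⁻¹]` and `[N; C]` are inverse to each other. -/
theorem mul_matN_add (hmn : m ≤ n) (hM : M.rank = n - m) (hCM : C * M = 0)
    (hCB : IsUnit (C * B).det) : M * matN B C M + B * (C * B)⁻¹ * C = 1 := by
  have h1 : Matrix.fromRows (matN B C M) C * Matrix.fromCols M (B * (C * B)⁻¹) = 1 := by
    rw [Matrix.fromRows_mul_fromCols, matN_mul_self hM hCM, hCM, ← Matrix.mul_assoc,
      matN_mul_input hCB, Matrix.zero_mul, ← Matrix.mul_assoc, Matrix.mul_nonsing_inv _ hCB,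
      Matrix.fromBlocks_one]
  have h2 := (Matrix.mul_eq_one_comm_of_card_eq _ _ _ (by simp [Nat.sub_add_cancel hmn])).1 h1
  rwa [Matrix.fromCols_mul_fromRows] at h2

/-- An eigenvector `v` of `N A M` gives the kernel vector `(M v, -(C B)⁻¹ C A M v)` of the system
matrix, so the eigenvalues of `N A M` are system zeros. -/
theorem IsMinimumPhase.isHurwitz_blockA11 (hmin : IsMinimumPhase A B C) (hmn : m ≤ n)
    (hM : M.rank = n - m) (hCM : C * M = 0) (hCB : IsUnit (C * B).det) :
    IsHurwitz (blockA11 A B C M) := by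
  intro s hs
  refine hmin s ?_
  have hmul : ∀ {p q r : ℕ} (X : Matrix (Fin p) (Fin q) ℝ) (Y : Matrix (Fin q) (Fin r) ℝ),
      (X * Y).map ((↑) : ℝ → ℂ) = X.map ((↑) : ℝ → ℂ) * Y.map ((↑) : ℝ → ℂ) := by
    intro p q r X Y
    exact Matrix.map_mul (f := Complex.ofRealHom)
  have hone : ∀ {p : ℕ}, (1 : Matrix (Fin p) (Fin p) ℝ).map ((↑) : ℝ → ℂ) = 1 := by
    intro p
    exact Matrix.map_one _ Complex.ofReal_zero Complex.ofReal_one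
  rw [← Matrix.spectrum_toLin', ← Module.End.hasEigenvalue_iff_mem_spectrum] at hs
  obtain ⟨v, hv⟩ := hs.exists_hasEigenvector
  have hv1 : ((blockA11 A B C M).map ((↑) : ℝ → ℂ)).mulVec v = s • v := by
    simpa using hv.apply_eq_smul
  set Ac := A.map ((↑) : ℝ → ℂ) with hAc
  set Bc := B.map ((↑) : ℝ → ℂ) with hBc
  set Cc := C.map ((↑) : ℝ → ℂ) with hCc
  set Mc := M.map ((↑) : ℝ → ℂ) with hMc
  set w := (((C * B)⁻¹ * C * A * M).map ((↑) : ℝ → ℂ)).mulVec v with hw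
  have hAM : A * M = M * blockA11 A B C M + B * ((C * B)⁻¹ * C * A * M) := by
    have h1 := congrArg (fun X => X * (A * M)) (mul_matN_add hmn hM hCM hCB)
    simp only [Matrix.one_mul, Matrix.add_mul] at h1
    rw [← h1, blockA11]
    simp only [Matrix.mul_assoc]
  have h2 : Ac.mulVec (Mc.mulVec v) = s • Mc.mulVec v + Bc.mulVec w := by
    have h3 := congrArg (fun X : Matrix (Fin n) (Fin (n - m)) ℝ =>
      (X.map ((↑) : ℝ → ℂ)).mulVec v) hAM
    have hadd : ∀ X Y : Matrix (Fin n) (Fin (n - m)) ℝ, (X + Y).map ((↑) : ℝ → ℂ) =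
        X.map ((↑) : ℝ → ℂ) + Y.map ((↑) : ℝ → ℂ) := fun X Y =>
      Matrix.map_add _ Complex.ofReal_add X Y
    simp only [hadd] at h3
    rw [hmul, hmul M, hmul B, Matrix.add_mulVec, ← Matrix.mulVec_mulVec, ← Matrix.mulVec_mulVec,
      ← Matrix.mulVec_mulVec, hv1, Matrix.mulVec_smul] at h3
    exact h3
  have hCMc : Cc.mulVec (Mc.mulVec v) = 0 := by
    rw [Matrix.mulVec_mulVec, hCc, hMc, ← hmul, hCM]
    ext i
    simp [Matrix.mulVec, dotProduct]
  have hne : Mc.mulVec v ≠ 0 := by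
    intro h0
    have h4 : ((matN B C M).map ((↑) : ℝ → ℂ)).mulVec (Mc.mulVec v) = v := by
      rw [Matrix.mulVec_mulVec, hMc, ← hmul, matN_mul_self hM hCM, hone, Matrix.one_mulVec]
    rw [h0, Matrix.mulVec_zero] at h4
    exact hv.2 h4.symm
  refine Matrix.exists_mulVec_eq_zero_iff.1 ⟨Sum.elim (Mc.mulVec v) (-w), ?_, ?_⟩
  · intro h0
    refine hne ?_
    ext i
    exact congrFun h0 (Sum.inl i)
  · rw [rosenbrock, Matrix.fromBlocks_mulVec]
    simp only [Sum.elim_comp_inl, Sum.elim_comp_inr]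
    rw [Matrix.sub_mulVec, Matrix.smul_mulVec, Matrix.one_mulVec, hCMc, Matrix.neg_mulVec,
      Matrix.mulVec_neg, neg_neg, h2]
    ext i
    rcases i with i | i <;> simp [hBc]

/-! ### Diagonal scaling and existence of the data for the gain bound -/

theorem isUnit_diagonal_det (hd : ∀ j, 0 < d j) : IsUnit (Matrix.diagonal d).det := by
  rw [Matrix.det_diagonal, isUnit_iff_ne_zero]
  exact Finset.prod_ne_zero_iff.2 fun j _ => (hd j).ne'

theorem diagonal_inv_eq (hd : ∀ j, 0 < d j) :
    (Matrix.diagonal d)⁻¹ = Matrix.diagonal fun j => (d j)⁻¹ := by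
  refine Matrix.inv_eq_right_inv ?_
  rw [Matrix.diagonal_mul_diagonal, ← Matrix.diagonal_one]
  congr 1
  ext j
  exact mul_inv_cancel₀ (hd j).ne'

theorem tildeB_apply (hd : ∀ j, 0 < d j) (i j : Fin m) :
    tildeB B C d i j = d i * (C * B) i j * (d j)⁻¹ := by
  rw [tildeB, diagonal_inv_eq hd, Matrix.mul_diagonal, Matrix.diagonal_mul]

theorem IsHurwitz.tildeB (hH : IsHurwitz (C * B)) (hd : ∀ j, 0 < d j) :
    IsHurwitz (tildeB B C d) := by
  refine hH.of_charpoly_eq ?_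
  have hu := (Matrix.isUnit_iff_isUnit_det _).2 (isUnit_diagonal_det hd)
  exact Matrix.charpoly_units_conj hu.unit (C * B)

/-- Positive weights for the comparison matrix are the diagonal scaling to column dominance. -/
theorem IsHMatrix.exists_isColDiagDominant_tildeB (hH : IsHMatrix (C * B)) :
    ∃ d : Fin m → ℝ, (∀ j, 0 < d j) ∧ IsColDiagDominant (tildeB B C d) := by
  obtain ⟨d, hd, hpos⟩ := IsMMatrix.exists_pos_vecMul_pos hH
  refine ⟨d, hd, fun j => ?_⟩
  have habs : ∀ i, |tildeB B C d i j| = d i * |(C * B) i j| * (d j)⁻¹ := by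
    intro i
    rw [tildeB_apply hd, abs_mul, abs_mul, abs_of_pos (hd i), abs_of_pos (inv_pos.2 (hd j))]
  simp_rw [habs]
  rw [← Finset.sum_mul]
  refine mul_lt_mul_of_pos_right ?_ (inv_pos.2 (hd j))
  have h1 := hpos j
  rw [← Finset.add_sum_erase _ _ (Finset.mem_univ j)] at h1
  have h2 : ∑ i ∈ Finset.univ.erase j, d i * comparisonMatrix (C * B) i j =
      -∑ i ∈ Finset.univ.erase j, d i * |(C * B) i j| := by
    rw [← Finset.sum_neg_distrib]
    refine Finset.sum_congr rfl fun i hi => ?_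
    simp [comparisonMatrix, Finset.ne_of_mem_erase hi]
  have h3 : comparisonMatrix (C * B) j j = |(C * B) j j| := by simp [comparisonMatrix]
  rw [h2, h3] at h1
  linarith

theorem colSumNorm_le {p q : ℕ} {X : Matrix (Fin p) (Fin q) ℝ} {K : ℝ} (hK : 0 ≤ K)
    (h : ∀ i j, |X i j| ≤ K) : colSumNorm X ≤ p * K := by
  refine Real.iSup_le (fun j => ?_) (by positivity)
  calc ∑ i, |X i j| ≤ ∑ _i : Fin p, K := Finset.sum_le_sum fun i _ => h i j
    _ = p * K := by simp

theorem exists_isBoundData (hC : C.rank = m) (hCB : (C * B).rank = m)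
    (hmin : IsMinimumPhase A B C) (hH : IsHMatrix (C * B)) :
    ∃ (M : Matrix (Fin n) (Fin (n - m)) ℝ) (d : Fin m → ℝ) (M₁₁ β₁₁ : ℝ),
      IsBoundData A B C M d M₁₁ β₁₁ := by
  have hmn : m ≤ n := hC ▸ C.rank_le_width
  obtain ⟨M, hCM, hM⟩ := C.exists_mul_eq_zero_and_rank_eq hC
  obtain ⟨d, hd, hdom⟩ := hH.exists_isColDiagDominant_tildeB
  obtain ⟨K, β, hK, hβ, hexp⟩ := (hmin.isHurwitz_blockA11 hmn hM hCM
    (Matrix.isUnit_det_of_rank_eq hCB)).exists_abs_exp_le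
  -- the summand `1` keeps the constant positive when `n = m`
  refine ⟨M, d, ((n - m : ℕ) + 1) * K, β, hCM, hM, hd, hdom, by positivity, hβ, fun t ht => ?_⟩
  refine (colSumNorm_le (by positivity) (hexp t ht)).trans ?_
  have := Real.exp_pos (-β * t)
  rw [← mul_assoc]
  gcongr
  linarith

end NormalForm

/-! ### Absolutely continuous functions and a Grönwall inequality -/

theorem LipschitzOnWith.comp_absolutelyContinuousOnInterval {f g : ℝ → ℝ} {a b : ℝ} {K : NNReal}
    {s : Set ℝ} (hg : LipschitzOnWith K g s) (hf : AbsolutelyContinuousOnInterval f a b)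
    (hs : MapsTo f (uIcc a b) s) : AbsolutelyContinuousOnInterval (fun t => g (f t)) a b := by
  rw [absolutelyContinuousOnInterval_iff] at hf ⊢
  intro ε hε
  obtain ⟨δ, hδ, h⟩ := hf (ε / (K + 1)) (by positivity)
  refine ⟨δ, hδ, fun E hE hlen => ?_⟩
  have h1 := h E hE hlen
  calc ∑ i ∈ Finset.range E.1, dist (g (f (E.2 i).1)) (g (f (E.2 i).2))
      ≤ ∑ i ∈ Finset.range E.1, (K + 1) * dist (f (E.2 i).1) (f (E.2 i).2) := by
        refine Finset.sum_le_sum fun i hi => ?_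
        refine (hg.dist_le_mul _ (hs (hE.1 i hi).1) _ (hs (hE.1 i hi).2)).trans ?_
        gcongr
        linarith
    _ = (K + 1) * ∑ i ∈ Finset.range E.1, dist (f (E.2 i).1) (f (E.2 i).2) := by
        rw [Finset.mul_sum]
    _ < (K + 1) * (ε / (K + 1)) := by gcongr
    _ = ε := by field_simp

theorem AbsolutelyContinuousOnInterval.abs {f : ℝ → ℝ} {a b : ℝ}
    (hf : AbsolutelyContinuousOnInterval f a b) :
    AbsolutelyContinuousOnInterval (fun t => |f t|) a b := by
  have h1 : LipschitzOnWith 1 (fun x : ℝ => |x|) univ :=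
    LipschitzOnWith.of_dist_le_mul fun x _ y _ => by
      simpa [Real.dist_eq] using abs_abs_sub_abs_le x y
  exact h1.comp_absolutelyContinuousOnInterval hf (mapsTo_univ _ _)

theorem AbsolutelyContinuousOnInterval.exp {f : ℝ → ℝ} {a b : ℝ}
    (hf : AbsolutelyContinuousOnInterval f a b) :
    AbsolutelyContinuousOnInterval (fun t => Real.exp (f t)) a b := by
  obtain ⟨C, hC⟩ := hf.exists_bound
  obtain ⟨K, hK⟩ := (Real.contDiff_exp (n := 1)).contDiffOn.exists_lipschitzOnWith (by decide)
    (convex_Icc (-C) C) isCompact_Icc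
  exact hK.comp_absolutelyContinuousOnInterval hf fun t ht => abs_le.1 (hC t ht)

theorem absolutelyContinuousOnInterval_const (c a b : ℝ) :
    AbsolutelyContinuousOnInterval (fun _ => c) a b :=
  contDiffOn_const.absolutelyContinuousOnInterval

theorem AbsolutelyContinuousOnInterval.finset_sum {ι : Type*} (s : Finset ι) {f : ι → ℝ → ℝ}
    {a b : ℝ} (hf : ∀ i ∈ s, AbsolutelyContinuousOnInterval (f i) a b) :
    AbsolutelyContinuousOnInterval (fun t => ∑ i ∈ s, f i t) a b := by
  classical
  induction s using Finset.induction_on with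
  | empty => simpa using absolutelyContinuousOnInterval_const 0 a b
  | insert i s hi ih =>
    simp_rw [Finset.sum_insert hi]
    exact (hf i (Finset.mem_insert_self i s)).fun_add
      (ih fun j hj => hf j (Finset.mem_insert_of_mem hj))

/-- Grönwall's inequality for absolutely continuous functions: the differential inequality is
needed only almost everywhere, and its coefficient need only be integrable. -/
theorem AbsolutelyContinuousOnInterval.le_exp_integral_mul {V ρ : ℝ → ℝ} {a b : ℝ} (hab : a ≤ b)
    (hV : AbsolutelyContinuousOnInterval V a b) (hρ : IntervalIntegrable ρ volume a b)
    (h : ∀ᵐ x, x ∈ Ioo a b → deriv V x ≤ ρ x * V x) :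
    V b ≤ Real.exp (∫ t in a..b, ρ t) * V a := by
  set E : ℝ → ℝ := fun t => Real.exp (-∫ s in a..t, ρ s) with hE
  have hEac : AbsolutelyContinuousOnInterval E a b :=
    (hρ.absolutelyContinuousOnInterval_intervalIntegral left_mem_uIcc).fun_neg.exp
  have hle : ∫ t in a..b, deriv (fun t => E t * V t) t ≤ 0 := by
    rw [intervalIntegral.integral_of_le hab, integral_Ioc_eq_integral_Ioo]
    refine integral_nonpos_of_ae ?_
    rw [EventuallyLE, ae_restrict_iff' measurableSet_Ioo]
    filter_upwards [h, hV.ae_differentiableAt, hρ.ae_hasDerivAt_integral] with x hx hVx hρx hxm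
    have hx' : x ∈ uIcc a b := by
      rw [uIcc_of_le hab]
      exact Ioo_subset_Icc_self hxm
    have h1 : HasDerivAt E (E x * -ρ x) x := (hρx hx' a left_mem_uIcc).fun_neg.exp
    have h2 := h1.fun_mul (hVx hx').hasDerivAt
    rw [h2.deriv]
    have h3 := mul_le_mul_of_nonneg_left (hx hxm) (Real.exp_pos (-∫ s in a..x, ρ s)).le
    change E x * deriv V x ≤ E x * (ρ x * V x) at h3
    simp only [Pi.zero_apply]
    linarith
  rw [(hEac.fun_mul hV).integral_deriv_eq_sub] at hle
  have hEa : E a = 1 := by simp [hE]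
  rw [hEa, one_mul] at hle
  have hEb : Real.exp (∫ t in a..b, ρ t) * E b = 1 := by
    rw [hE, ← Real.exp_add]
    simp
  calc V b = Real.exp (∫ t in a..b, ρ t) * (E b * V b) := by rw [← mul_assoc, hEb, one_mul]
    _ ≤ Real.exp (∫ t in a..b, ρ t) * V a :=
        mul_le_mul_of_nonneg_left (by linarith) (Real.exp_pos _).le

/-- The derivative of `|u|` when `u' = q u + f`. At a zero of `u` the function `|u|` has a minimum,
so its derivative vanishes there (also by convention, if it does not exist). -/
theorem deriv_abs_le {u : ℝ → ℝ} {q f x : ℝ} (hu : HasDerivAt u (q * u x + f) x) :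
    deriv (fun t => |u t|) x ≤ q * |u x| + |f| := by
  rcases lt_trichotomy (u x) 0 with h | h | h
  · have h1 := (hasDerivAt_abs_neg h).comp x hu
    have h2 : deriv (fun t => |u t|) x = -1 * (q * u x + f) := h1.deriv
    rw [h2, abs_of_neg h]
    linarith [neg_abs_le f]
  · have hmin : IsLocalMin (fun t => |u t|) x :=
      Eventually.of_forall fun t => by simp [h]
    rw [hmin.deriv_eq_zero, h]
    simp
  · have h1 := (hasDerivAt_abs_pos h).comp x hu
    have h2 : deriv (fun t => |u t|) x = 1 * (q * u x + f) := h1.deriv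
    rw [h2, abs_of_pos h]
    linarith [le_abs_self f]

theorem ContinuousOn.hasDerivAt_primitive {w : ℝ → ℝ} {a b t : ℝ} (hw : ContinuousOn w (Icc a b))
    (ht : t ∈ Ioo a b) : HasDerivAt (fun u => ∫ s in a..u, w s) (w t) t := by
  refine intervalIntegral.integral_hasDerivAt_right ?_ ?_ ?_
  · exact ContinuousOn.intervalIntegrable_of_Icc ht.1.le
      (hw.mono (Icc_subset_Icc_right ht.2.le))
  · exact (hw.mono Ioo_subset_Icc_self).stronglyMeasurableAtFilter isOpen_Ioo t ht
  · exact hw.continuousAt (Icc_mem_nhds ht.1 ht.2)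

/-! ### The vector 1-norm and the induced matrix norm -/

theorem colSumNorm_nonneg {p q : ℕ} (X : Matrix (Fin p) (Fin q) ℝ) : 0 ≤ colSumNorm X :=
  Real.iSup_nonneg fun _ => Finset.sum_nonneg fun _ _ => abs_nonneg _

theorem sum_abs_mulVec_le {p q : ℕ} (X : Matrix (Fin p) (Fin q) ℝ) (v : Fin q → ℝ) :
    ∑ i, |X.mulVec v i| ≤ colSumNorm X * ∑ j, |v j| := by
  calc ∑ i, |X.mulVec v i| ≤ ∑ i, ∑ j, |X i j| * |v j| := by
        refine Finset.sum_le_sum fun i _ => ?_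
        simp_rw [← abs_mul]
        change |∑ j, X i j * v j| ≤ _
        exact Finset.abs_sum_le_sum_abs _ _
    _ = ∑ j, (∑ i, |X i j|) * |v j| := by
        rw [Finset.sum_comm]
        simp_rw [Finset.sum_mul]
    _ ≤ ∑ j, colSumNorm X * |v j| := by
        refine Finset.sum_le_sum fun j _ => mul_le_mul_of_nonneg_right ?_ (abs_nonneg _)
        exact le_ciSup (f := fun j => ∑ i, |X i j|) (Finite.bddAbove_range _) j
    _ = _ := by rw [Finset.mul_sum]

theorem norm_toLp_le_sum_abs {n : ℕ} (x : Fin n → ℝ) : ‖WithLp.toLp 2 x‖ ≤ ∑ i, |x i| := by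
  rw [EuclideanSpace.norm_eq]
  refine Real.sqrt_le_iff.2 ⟨Finset.sum_nonneg fun _ _ => abs_nonneg _, ?_⟩
  exact Finset.sum_sq_le_sq_sum_of_nonneg (f := fun i => |x i|) fun i _ => abs_nonneg (x i)

theorem sum_abs_le_mul_norm_toLp {n : ℕ} (x : Fin n → ℝ) :
    ∑ i, |x i| ≤ n * ‖WithLp.toLp 2 x‖ := by
  calc ∑ i, |x i| ≤ ∑ _i : Fin n, ‖WithLp.toLp 2 x‖ :=
        Finset.sum_le_sum fun i _ => PiLp.norm_apply_le (WithLp.toLp 2 x) i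
    _ = _ := by simp

/-! ### Variation of constants -/

open scoped Matrix.Norms.Operator in
theorem Matrix.hasDerivAt_exp_smul_apply {p : ℕ} (X : Matrix (Fin p) (Fin p) ℝ) (T s : ℝ)
    (i j : Fin p) :
    HasDerivAt (fun s => NormedSpace.exp ((T - s) • X) i j)
      (-(NormedSpace.exp ((T - s) • X) * X) i j) s := by
  have h1 := (hasDerivAt_exp_smul_const (𝕂 := ℝ) X (T - s)).scomp s
    ((hasDerivAt_id s).const_sub T)
  have h2 := ((Matrix.entryLinearMap ℝ ℝ i j).toContinuousLinearMap).hasFDerivAt.comp_hasDerivAt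
    s h1
  refine h2.congr_deriv ?_
  rw [neg_one_smul]
  rfl

/-- The variation-of-constants estimate: if `‖exp (t X)‖₁ ≤ K e ^ (-β t)`, solutions of
`z' = X z + f` are bounded by a scalar convolution. -/
theorem sum_abs_le_of_hasDerivAt {p : ℕ} {X : Matrix (Fin p) (Fin p) ℝ} {K β : ℝ}
    (hexp : ∀ t : ℝ, 0 ≤ t → colSumNorm (NormedSpace.exp (t • X)) ≤ K * Real.exp (-β * t))
    {z f : ℝ → Fin p → ℝ} {a T : ℝ} (haT : a ≤ T) (hz : ContinuousOn z (Icc a T))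
    (hf : ContinuousOn f (Icc a T))
    (hderiv : ∀ s ∈ Ioo a T, ∀ i, HasDerivAt (fun t => z t i) (X.mulVec (z s) i + f s i) s) :
    ∑ i, |z T i| ≤ K * Real.exp (-β * (T - a)) *
      (∑ i, |z a i| + ∫ s in a..T, Real.exp (β * (s - a)) * ∑ i, |f s i|) := by
  set E : ℝ → Matrix (Fin p) (Fin p) ℝ := fun s => NormedSpace.exp ((T - s) • X) with hE
  have hEd : ∀ s i j, HasDerivAt (fun s => E s i j) (-(E s * X) i j) s := fun s i j =>
    Matrix.hasDerivAt_exp_smul_apply X T s i j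
  have hEc : ∀ i j, Continuous fun s => E s i j := fun i j =>
    continuous_iff_continuousAt.2 fun s => (hEd s i j).continuousAt
  have hzc : ∀ i, ContinuousOn (fun s => z s i) (Icc a T) := fun i =>
    continuousOn_pi.1 hz i
  have hfc : ∀ i, ContinuousOn (fun s => f s i) (Icc a T) := fun i =>
    continuousOn_pi.1 hf i
  have hEv : ∀ {w : ℝ → Fin p → ℝ}, (∀ i, ContinuousOn (fun s => w s i) (Icc a T)) → ∀ i,
      ContinuousOn (fun s => (E s).mulVec (w s) i) (Icc a T) := by
    intro w hw i
    simp only [Matrix.mulVec, dotProduct]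
    exact continuousOn_finsetSum _ fun j _ => (hEc i j).continuousOn.fun_mul (hw j)
  have hvar : ∀ i, z T i = (E a).mulVec (z a) i + ∫ s in a..T, (E s).mulVec (f s) i := by
    intro i
    have hint := intervalIntegral.integral_eq_sub_of_hasDerivAt_of_le haT (hEv hzc i)
      (f' := fun s => (E s).mulVec (f s) i) (fun s hs => ?_)
      ((hEv hfc i).intervalIntegrable_of_Icc haT)
    · have hET : E T = 1 := by simp [hE]
      rw [hint, hET, Matrix.one_mulVec]
      ring
    · have h1 : HasDerivAt (fun s => ∑ j, E s i j * z s j)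
          (∑ j, (-(E s * X) i j * z s j + E s i j * (X.mulVec (z s) j + f s j))) s :=
        HasDerivAt.fun_sum fun j _ => (hEd s i j).fun_mul (hderiv s hs j)
      have h2 : ∑ j, (-(E s * X) i j * z s j + E s i j * (X.mulVec (z s) j + f s j)) =
          (E s).mulVec (f s) i := by
        have h3 : ((E s * X).mulVec (z s)) i = (E s).mulVec (X.mulVec (z s)) i := by
          rw [Matrix.mulVec_mulVec]
        simp only [Matrix.mulVec, dotProduct] at h3 ⊢
        simp only [mul_add, Finset.sum_add_distrib, neg_mul, Finset.sum_neg_distrib]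
        rw [h3]
        ring
      rw [h2] at h1
      exact h1
  have hEb : ∀ s ≤ T, colSumNorm (E s) ≤ K * Real.exp (-β * (T - a)) * Real.exp (β * (s - a)) := by
    intro s hs
    refine (hexp (T - s) (sub_nonneg.2 hs)).trans (le_of_eq ?_)
    rw [mul_assoc, ← Real.exp_add]
    congr 2
    ring
  have habs : ∀ i, IntervalIntegrable (fun s => |(E s).mulVec (f s) i|) volume a T := fun i =>
    ((hEv hfc i).abs).intervalIntegrable_of_Icc haT
  calc ∑ i, |z T i|
      ≤ ∑ i, (|(E a).mulVec (z a) i| + ∫ s in a..T, |(E s).mulVec (f s) i|) := by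
        refine Finset.sum_le_sum fun i _ => ?_
        rw [hvar i]
        exact (abs_add_le _ _).trans
          (add_le_add le_rfl (intervalIntegral.abs_integral_le_integral_abs haT))
    _ = ∑ i, |(E a).mulVec (z a) i| + ∫ s in a..T, ∑ i, |(E s).mulVec (f s) i| := by
        rw [Finset.sum_add_distrib, intervalIntegral.integral_finsetSum fun i _ => habs i]
    _ ≤ K * Real.exp (-β * (T - a)) * ∑ i, |z a i| + ∫ s in a..T,
          K * Real.exp (-β * (T - a)) * (Real.exp (β * (s - a)) * ∑ i, |f s i|) := by
        refine add_le_add ?_ ?_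
        · refine (sum_abs_mulVec_le _ _).trans
            (mul_le_mul_of_nonneg_right ?_ (Finset.sum_nonneg fun _ _ => abs_nonneg _))
          simpa using hEb a haT
        · refine intervalIntegral.integral_mono_on haT ?_ ?_ fun s hs => ?_
          · exact (continuousOn_finsetSum _ fun i _ =>
              (hEv hfc i).abs).intervalIntegrable_of_Icc haT
          · refine ContinuousOn.intervalIntegrable_of_Icc haT (continuousOn_const.mul ?_)
            exact ContinuousOn.mul (by fun_prop) (continuousOn_finsetSum _ fun i _ => (hfc i).abs)
          · refine (sum_abs_mulVec_le _ _).trans ?_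
            rw [← mul_assoc]
            exact mul_le_mul_of_nonneg_right (hEb s hs.2)
              (Finset.sum_nonneg fun _ _ => abs_nonneg _)
    _ = _ := by
        rw [intervalIntegral.integral_const_mul]
        ring

/-! ### The small-gain estimate -/

/-- The off-diagonal terms of the output equation, summed over the rows, are controlled column by
column. -/
theorem sum_abs_offDiag_le {m : ℕ} (P Q : Matrix (Fin m) (Fin m) ℝ) (k y c : Fin m → ℝ) :
    ∑ j, |c j + ∑ l ∈ Finset.univ.erase j, (P j l + Q j l * k l) * y l| ≤
      ∑ j, |c j| + ∑ l, (∑ j ∈ Finset.univ.erase l, |P j l| +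
        |k l| * ∑ j ∈ Finset.univ.erase l, |Q j l|) * |y l| := by
  have hswap : ∑ j, ∑ l ∈ Finset.univ.erase j, (|P j l| + |k l| * |Q j l|) * |y l| =
      ∑ l, (∑ j ∈ Finset.univ.erase l, |P j l| +
        |k l| * ∑ j ∈ Finset.univ.erase l, |Q j l|) * |y l| := by
    simp_rw [Finset.mul_sum, ← Finset.sum_add_distrib, Finset.sum_mul]
    refine Finset.sum_comm' ?_
    intro i l
    simp [eq_comm]
  rw [← hswap, ← Finset.sum_add_distrib]
  refine Finset.sum_le_sum fun j _ => (abs_add_le _ _).trans (add_le_add le_rfl ?_)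
  refine (Finset.abs_sum_le_sum_abs _ _).trans (Finset.sum_le_sum fun l _ => ?_)
  rw [abs_mul]
  refine mul_le_mul_of_nonneg_right ((abs_add_le _ _).trans (le_of_eq ?_)) (abs_nonneg _)
  rw [abs_mul, mul_comm |k l|]

/-- The Lyapunov estimate for the normal form `z' = A₁₁ z + A₁₂ y`,
`y' = A₂₁ z + A₂₂ y + Bt K y`. Let `U` be the scalar majorant of `‖z‖₁` given by variation of
constants, so that `U' = -β U + M ‖A₁₂‖₁ ‖y‖₁`. Then `V = ‖y‖₁ + μ U` satisfies `V' ≤ ρ V` almost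
everywhere as soon as `ρ` dominates the columns of the output equation and the coefficient
`‖A₂₁‖₁ / μ - β` of `U`. -/
theorem sum_abs_add_mul_sum_abs_le {p m : ℕ} {A₁₁ : Matrix (Fin p) (Fin p) ℝ}
    {A₁₂ : Matrix (Fin p) (Fin m) ℝ} {A₂₁ : Matrix (Fin m) (Fin p) ℝ}
    {A₂₂ Bt : Matrix (Fin m) (Fin m) ℝ} {K β μ : ℝ} (hμ : 0 ≤ μ)
    (hexp : ∀ t : ℝ, 0 ≤ t → colSumNorm (NormedSpace.exp (t • A₁₁)) ≤ K * Real.exp (-β * t))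
    {k : ℝ → Fin m → ℝ} {ρ : ℝ → ℝ} {a T : ℝ} (haT : a ≤ T)
    (hρ : IntervalIntegrable ρ volume a T)
    (hρU : ∀ s ∈ Ioo a T, colSumNorm A₂₁ ≤ μ * (β + ρ s))
    (hρy : ∀ s ∈ Ioo a T, ∀ j, (A₂₂ j j + Bt j j * k s j) +
      (∑ i ∈ Finset.univ.erase j, |A₂₂ i j| + |k s j| * ∑ i ∈ Finset.univ.erase j, |Bt i j|) +
      μ * (K * colSumNorm A₁₂) ≤ ρ s)
    {z : ℝ → Fin p → ℝ} {y : ℝ → Fin m → ℝ}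
    (hz : ContinuousOn z (Icc a T)) (hy : ContinuousOn y (Icc a T))
    (hzd : ∀ s ∈ Ioo a T, ∀ i, HasDerivAt (fun t => z t i)
      (A₁₁.mulVec (z s) i + A₁₂.mulVec (y s) i) s)
    (hyac : ∀ j, AbsolutelyContinuousOnInterval (fun t => y t j) a T)
    (hyd : ∀ᵐ s, s ∈ Ioo a T → ∀ j, HasDerivAt (fun t => y t j)
      (A₂₁.mulVec (z s) j + A₂₂.mulVec (y s) j + Bt.mulVec (fun l => k s l * y s l) j) s) :
    ∑ j, |y T j| + μ * ∑ i, |z T i| ≤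
      Real.exp (∫ s in a..T, ρ s) * (∑ j, |y a j| + μ * (K * ∑ i, |z a i|)) := by
  set ψ : ℝ → ℝ := fun s => colSumNorm A₁₂ * ∑ j, |y s j| with hψ
  set I : ℝ → ℝ := fun t => ∫ s in a..t, Real.exp (β * (s - a)) * ψ s with hI
  set U : ℝ → ℝ := fun t => K * Real.exp (-β * (t - a)) * (∑ i, |z a i| + I t) with hU
  have hK : 0 ≤ K := by
    have := (colSumNorm_nonneg _).trans (hexp 0 le_rfl)
    simpa using this
  have hyc : ∀ j, ContinuousOn (fun s => y s j) (Icc a T) := fun j => continuousOn_pi.1 hy j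
  have hψc : ContinuousOn ψ (Icc a T) :=
    continuousOn_const.mul (continuousOn_finsetSum _ fun j _ => (hyc j).abs)
  have hwc : ContinuousOn (fun s => Real.exp (β * (s - a)) * ψ s) (Icc a T) :=
    ContinuousOn.mul (by fun_prop) hψc
  have hzU : ∀ t ∈ Icc a T, ∑ i, |z t i| ≤ U t := by
    intro t ht
    have hsub : Icc a t ⊆ Icc a T := Icc_subset_Icc_right ht.2
    have hA12 : ContinuousOn (fun s => A₁₂.mulVec (y s)) (Icc a T) :=
      (Continuous.matrix_mulVec continuous_const continuous_id).comp_continuousOn hy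
    refine (sum_abs_le_of_hasDerivAt hexp ht.1 (hz.mono hsub) (hA12.mono hsub)
      fun s hs i => hzd s ⟨hs.1, hs.2.trans_le ht.2⟩ i).trans ?_
    refine mul_le_mul_of_nonneg_left (add_le_add le_rfl ?_)
      (mul_nonneg hK (Real.exp_pos _).le)
    refine intervalIntegral.integral_mono_on ht.1 ?_ ?_ fun s _ =>
      mul_le_mul_of_nonneg_left (sum_abs_mulVec_le _ _) (Real.exp_pos _).le
    · refine ContinuousOn.intervalIntegrable_of_Icc ht.1 (ContinuousOn.mul (by fun_prop) ?_)
      exact continuousOn_finsetSum _ fun i _ => (continuousOn_pi.1 (hA12.mono hsub) i).abs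
    · exact (hwc.mono hsub).intervalIntegrable_of_Icc ht.1
  have hUac : AbsolutelyContinuousOnInterval U a T := by
    refine AbsolutelyContinuousOnInterval.fun_mul (f := fun t => K * Real.exp (-β * (t - a))) ?_ ?_
    · refine ContDiffOn.absolutelyContinuousOnInterval (ContDiff.contDiffOn ?_)
      fun_prop
    · exact (absolutelyContinuousOnInterval_const _ _ _).fun_add
        ((hwc.intervalIntegrable_of_Icc haT).absolutelyContinuousOnInterval_intervalIntegral
          left_mem_uIcc)
  have hUd : ∀ s ∈ Ioo a T, HasDerivAt U (-β * U s + K * ψ s) s := by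
    intro s hs
    have h1 : HasDerivAt (fun t => K * Real.exp (-β * (t - a)))
        (K * (Real.exp (-β * (s - a)) * (-β * 1))) s :=
      ((((hasDerivAt_id s).sub_const a).const_mul (-β)).exp).const_mul K
    have h2 := h1.fun_mul ((hwc.hasDerivAt_primitive hs).const_add (∑ i, |z a i|))
    refine h2.congr_deriv ?_
    have h3 : Real.exp (-β * (s - a)) * Real.exp (β * (s - a)) = 1 := by
      rw [← Real.exp_add]
      simp
    change _ = -β * (K * Real.exp (-β * (s - a)) * (∑ i, |z a i| + I s)) + K * ψ s
    linear_combination (K * ψ s) * h3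
  have hYac : AbsolutelyContinuousOnInterval (fun t => ∑ j, |y t j|) a T :=
    AbsolutelyContinuousOnInterval.finset_sum _ fun j _ => (hyac j).abs
  have hVac : AbsolutelyContinuousOnInterval (fun t => ∑ j, |y t j| + μ * U t) a T :=
    hYac.fun_add (hUac.const_mul μ)
  have hgron := hVac.le_exp_integral_mul haT hρ ?_
  · have hUa : U a = K * ∑ i, |z a i| := by simp [hU, hI]
    rw [hUa] at hgron
    exact (add_le_add le_rfl (mul_le_mul_of_nonneg_left (hzU T (right_mem_Icc.2 haT)) hμ)).trans
      hgron
  · have hdiff : ∀ᵐ s, ∀ j, s ∈ uIcc a T → DifferentiableAt ℝ (fun t => |y t j|) s :=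
      ae_all_iff.2 fun j => (hyac j).abs.ae_differentiableAt
    filter_upwards [hyd, hdiff] with s hs hds hsm
    have hs' : s ∈ uIcc a T := by
      rw [uIcc_of_le haT]
      exact Ioo_subset_Icc_self hsm
    have hsum : HasDerivAt (fun t => ∑ j, |y t j| + μ * U t)
        (∑ j, deriv (fun t => |y t j|) s + μ * (-β * U s + K * ψ s)) s :=
      (HasDerivAt.fun_sum fun j _ => (hds j hs').hasDerivAt).fun_add
        ((hUd s hsm).const_mul μ)
    rw [hsum.deriv]
    have hcol : ∀ j, deriv (fun t => |y t j|) s ≤ (A₂₂ j j + Bt j j * k s j) * |y s j| +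
        |A₂₁.mulVec (z s) j +
          ∑ l ∈ Finset.univ.erase j, (A₂₂ j l + Bt j l * k s l) * y s l| := by
      intro j
      refine deriv_abs_le ((hs hsm j).congr_deriv ?_)
      have h1 : A₂₂.mulVec (y s) j + Bt.mulVec (fun l => k s l * y s l) j =
          ∑ l, (A₂₂ j l + Bt j l * k s l) * y s l := by
        simp only [Matrix.mulVec, dotProduct]
        rw [← Finset.sum_add_distrib]
        exact Finset.sum_congr rfl fun l _ => by ring
      rw [add_assoc, h1, ← Finset.add_sum_erase _ _ (Finset.mem_univ j)]
      ring
    have hY : ∑ j, deriv (fun t => |y t j|) s ≤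
        ∑ j, ((A₂₂ j j + Bt j j * k s j) + (∑ i ∈ Finset.univ.erase j, |A₂₂ i j| +
          |k s j| * ∑ i ∈ Finset.univ.erase j, |Bt i j|)) * |y s j| + colSumNorm A₂₁ * U s := by
      have h2 := Finset.sum_le_sum fun j (_ : j ∈ Finset.univ) => hcol j
      rw [Finset.sum_add_distrib] at h2
      have h3 := sum_abs_offDiag_le A₂₂ Bt (k s) (y s) (A₂₁.mulVec (z s))
      have h4 : ∑ j, |A₂₁.mulVec (z s) j| ≤ colSumNorm A₂₁ * U s :=
        (sum_abs_mulVec_le _ _).trans (mul_le_mul_of_nonneg_left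
          (hzU s (Ioo_subset_Icc_self hsm)) (colSumNorm_nonneg _))
      simp_rw [add_mul _ (_ + _) |y s _|]
      rw [Finset.sum_add_distrib]
      linarith
    have hρsum : ∑ j, ((A₂₂ j j + Bt j j * k s j) + (∑ i ∈ Finset.univ.erase j, |A₂₂ i j| +
        |k s j| * ∑ i ∈ Finset.univ.erase j, |Bt i j|)) * |y s j| +
        μ * (K * ψ s) ≤ ρ s * ∑ j, |y s j| := by
      have h5 : μ * (K * ψ s) = ∑ j, μ * (K * colSumNorm A₁₂) * |y s j| := by
        rw [hψ, ← Finset.mul_sum]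
        ring
      rw [h5, ← Finset.sum_add_distrib, Finset.mul_sum]
      refine Finset.sum_le_sum fun j _ => ?_
      rw [← add_mul]
      exact mul_le_mul_of_nonneg_right (hρy s hsm j) (abs_nonneg _)
    have hU0 : 0 ≤ U s := (Finset.sum_nonneg fun _ _ => abs_nonneg _).trans
      (hzU s (Ioo_subset_Icc_self hsm))
    have hUle := mul_le_mul_of_nonneg_right (hρU s hsm) hU0
    linarith

/-! ### The closed loop in normal-form coordinates -/

section ClosedLoop

variable {n m : ℕ} {A : Matrix (Fin n) (Fin n) ℝ} {B : Matrix (Fin n) (Fin m) ℝ}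
  {C : Matrix (Fin m) (Fin n) ℝ} {M : Matrix (Fin n) (Fin (n - m)) ℝ} {d : Fin m → ℝ}

theorem mul_matN_add_scaled (hmn : m ≤ n) (hM : M.rank = n - m) (hCM : C * M = 0)
    (hCB : IsUnit (C * B).det) (hd : ∀ j, 0 < d j) :
    M * matN B C M + B * (C * B)⁻¹ * (Matrix.diagonal d)⁻¹ * (Matrix.diagonal d * C) = 1 := by
  rw [Matrix.mul_assoc (B * (C * B)⁻¹), ← Matrix.mul_assoc (Matrix.diagonal d)⁻¹,
    Matrix.nonsing_inv_mul _ (isUnit_diagonal_det hd), Matrix.one_mul,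
    mul_matN_add hmn hM hCM hCB]

/-- The gain does not enter the equation of `z = N x`, because `N B = 0`. -/
theorem matN_mul_closedLoop (hmn : m ≤ n) (hM : M.rank = n - m) (hCM : C * M = 0)
    (hCB : IsUnit (C * B).det) (hd : ∀ j, 0 < d j) (k : Fin m → ℝ → ℝ) (t : ℝ) :
    matN B C M * closedLoop A B C k t =
      blockA11 A B C M * matN B C M + tildeA12 A B C M d * (Matrix.diagonal d * C) := by
  have h1 := congrArg (fun X => matN B C M * A * X) (mul_matN_add_scaled hmn hM hCM hCB hd)
  simp only [Matrix.mul_one, Matrix.mul_add] at h1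
  rw [closedLoop, Matrix.mul_add, ← Matrix.mul_assoc, ← Matrix.mul_assoc, matN_mul_input hCB,
    Matrix.zero_mul, Matrix.zero_mul, add_zero, ← h1, blockA11, tildeA12]
  simp only [Matrix.mul_assoc]

/-- The gain enters the equation of the scaled output `y = D C x` through `D C B D⁻¹ K`, because
the diagonal matrices `D` and `K` commute. -/
theorem scaledOutput_mul_closedLoop (hmn : m ≤ n) (hM : M.rank = n - m) (hCM : C * M = 0)
    (hCB : IsUnit (C * B).det) (hd : ∀ j, 0 < d j) (k : Fin m → ℝ → ℝ) (t : ℝ) :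
    Matrix.diagonal d * C * closedLoop A B C k t =
      tildeA21 A C M d * matN B C M + tildeA22 A B C d * (Matrix.diagonal d * C) +
        tildeB B C d * Matrix.diagonal (fun i => k i t) * (Matrix.diagonal d * C) := by
  have h1 := congrArg (fun X => Matrix.diagonal d * C * A * X)
    (mul_matN_add_scaled hmn hM hCM hCB hd)
  simp only [Matrix.mul_one, Matrix.mul_add] at h1
  have h2 : (Matrix.diagonal d)⁻¹ * Matrix.diagonal (fun i => k i t) * Matrix.diagonal d =
      Matrix.diagonal fun i => k i t := by
    rw [diagonal_inv_eq hd, Matrix.diagonal_mul_diagonal, Matrix.diagonal_mul_diagonal]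
    congr 1
    ext i
    have := (hd i).ne'
    field_simp
  have h3 : tildeB B C d * Matrix.diagonal (fun i => k i t) * (Matrix.diagonal d * C) =
      Matrix.diagonal d * C * (B * Matrix.diagonal (fun i => k i t) * C) := by
    conv_rhs => rw [← h2]
    rw [tildeB]
    simp only [Matrix.mul_assoc]
  rw [h3, closedLoop, Matrix.mul_add, ← h1, tildeA21, tildeA22]
  simp only [Matrix.mul_assoc]

theorem intervalIntegrable_closedLoop_mulVec {k : Fin m → ℝ → ℝ} {a T : ℝ} (haT : a ≤ T)
    (hk : ∀ i, IntervalIntegrable (k i) volume a T) {x : ℝ → Fin n → ℝ}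
    (hx : ContinuousOn x (Icc a T)) :
    IntervalIntegrable (fun s => (closedLoop A B C k s).mulVec (x s)) volume a T := by
  have hmul : ∀ {p : ℕ} (X : Matrix (Fin p) (Fin n) ℝ) (i : Fin p),
      ContinuousOn (fun s => X.mulVec (x s) i) (Icc a T) := fun X i =>
    continuousOn_pi.1 ((Continuous.matrix_mulVec continuous_const continuous_id).comp_continuousOn
      hx) i
  have hcomp : ∀ i, IntervalIntegrable
      (fun s => (closedLoop A B C k s).mulVec (x s) i) volume a T := by
    intro i
    have heq : (fun s => (closedLoop A B C k s).mulVec (x s) i) =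
        fun s => A.mulVec (x s) i + (∑ l, fun s => B i l * (k l s * C.mulVec (x s) l)) s := by
      ext s
      rw [closedLoop, Matrix.add_mulVec, ← Matrix.mulVec_mulVec, ← Matrix.mulVec_mulVec,
        Pi.add_apply, Finset.sum_apply]
      congr 1
      rw [Matrix.mulVec, dotProduct]
      refine Finset.sum_congr rfl fun l _ => ?_
      rw [Matrix.mulVec_diagonal]
    rw [heq]
    refine ((hmul A i).intervalIntegrable_of_Icc haT).add (IntervalIntegrable.sum _ fun l _ => ?_)
    refine ((hk l).mul_continuousOn ?_).const_mul _
    rw [uIcc_of_le haT]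
    exact hmul C l
  refine ⟨Integrable.of_eval fun i => (hcomp i).1, Integrable.of_eval fun i => (hcomp i).2⟩

/-- A linear image of a solution is the primitive of the linear image of the right-hand side. -/
theorem IsSolutionFrom.mulVec_eq {k : Fin m → ℝ → ℝ} {a T : ℝ}
    (hk : ∀ i, IntervalIntegrable (k i) volume a T) {x : ℝ → Fin n → ℝ}
    (hx : IsSolutionFrom (closedLoop A B C k) a x) {p : ℕ} (W : Matrix (Fin p) (Fin n) ℝ)
    (i : Fin p) {t : ℝ} (ht : t ∈ Icc a T) :
    W.mulVec (x t) i = W.mulVec (x a) i +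
      ∫ s in a..t, (W * closedLoop A B C k s).mulVec (x s) i := by
  have hk' : ∀ i, IntervalIntegrable (k i) volume a t := fun i =>
    (hk i).mono_set (by
      rw [uIcc_of_le ht.1, uIcc_of_le (ht.1.trans ht.2)]
      exact Icc_subset_Icc_right ht.2)
  have hint := intervalIntegrable_closedLoop_mulVec (A := A) (B := B) (C := C) ht.1 hk'
    (hx.1.mono Icc_subset_Ici_self)
  let L : (Fin n → ℝ) →L[ℝ] ℝ :=
    ((LinearMap.proj i).comp W.mulVecLin).toContinuousLinearMap
  have h1 := L.intervalIntegral_comp_comm hint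
  have h2 : ∀ v, L v = W.mulVec v i := fun v => rfl
  have h3 : W.mulVec (x t) i = L (x t) := rfl
  rw [h3, hx.2 t ht.1, map_add, ← h1, h2]
  simp only [h2, Matrix.mulVec_mulVec]

/-- Solutions of the closed loop obey the small-gain estimate in the coordinates `z = N x`,
`y = D C x`. -/
theorem IsSolutionFrom.sum_abs_output_add_le (hmn : m ≤ n) {K β μ : ℝ}
    (hdata : IsBoundData A B C M d K β) (hCB : IsUnit (C * B).det) (hμ : 0 ≤ μ)
    {k : Fin m → ℝ → ℝ} {ρ : ℝ → ℝ} {a T : ℝ} (haT : a ≤ T)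
    (hk : ∀ i, IntervalIntegrable (k i) volume a T)
    (hρ : IntervalIntegrable ρ volume a T)
    (hρU : ∀ s ∈ Ioo a T, colSumNorm (tildeA21 A C M d) ≤ μ * (β + ρ s))
    (hρy : ∀ s ∈ Ioo a T, ∀ j, (tildeA22 A B C d j j + tildeB B C d j j * k j s) +
      (∑ i ∈ Finset.univ.erase j, |tildeA22 A B C d i j| +
        |k j s| * ∑ i ∈ Finset.univ.erase j, |tildeB B C d i j|) +
      μ * (K * colSumNorm (tildeA12 A B C M d)) ≤ ρ s)
    {x : ℝ → Fin n → ℝ} (hx : IsSolutionFrom (closedLoop A B C k) a x) :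
    ∑ j, |(Matrix.diagonal d * C).mulVec (x T) j| + μ * ∑ i, |(matN B C M).mulVec (x T) i| ≤
      Real.exp (∫ s in a..T, ρ s) * (∑ j, |(Matrix.diagonal d * C).mulVec (x a) j| +
        μ * (K * ∑ i, |(matN B C M).mulVec (x a) i|)) := by
  have hM := hdata.rank_eq
  have hCM := hdata.mul_eq_zero
  have hd := hdata.d_pos
  have hxc : ContinuousOn x (Icc a T) := hx.1.mono Icc_subset_Ici_self
  have hmulc : ∀ {p : ℕ} (X : Matrix (Fin p) (Fin n) ℝ),
      ContinuousOn (fun s => X.mulVec (x s)) (Icc a T) := fun X =>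
    (Continuous.matrix_mulVec continuous_const continuous_id).comp_continuousOn hxc
  set L := Matrix.diagonal d * C with hL
  set N := matN B C M with hN
  have hNx : ∀ s, (N * closedLoop A B C k s).mulVec (x s) =
      (blockA11 A B C M * N + tildeA12 A B C M d * L).mulVec (x s) := fun s => by
    rw [hN, matN_mul_closedLoop hmn hM hCM hCB hd]
  have hNx' : ∀ s i, (N * closedLoop A B C k s).mulVec (x s) i =
      (blockA11 A B C M).mulVec (N.mulVec (x s)) i +
        (tildeA12 A B C M d).mulVec (L.mulVec (x s)) i := fun s i => by
    rw [hNx, Matrix.add_mulVec, ← Matrix.mulVec_mulVec, ← Matrix.mulVec_mulVec, Pi.add_apply]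
  have hLx : ∀ s j, (L * closedLoop A B C k s).mulVec (x s) j =
      (tildeA21 A C M d).mulVec (N.mulVec (x s)) j +
        (tildeA22 A B C d).mulVec (L.mulVec (x s)) j +
        (tildeB B C d).mulVec (fun l => k l s * L.mulVec (x s) l) j := fun s j => by
    have h1 : (Matrix.diagonal fun i => k i s).mulVec (L.mulVec (x s)) =
        fun l => k l s * L.mulVec (x s) l := by
      ext l
      rw [Matrix.mulVec_diagonal]
    rw [hL, scaledOutput_mul_closedLoop hmn hM hCM hCB hd, ← hL, Matrix.add_mulVec,
      Matrix.add_mulVec, ← hN, ← Matrix.mulVec_mulVec (x s) _ N, ← Matrix.mulVec_mulVec (x s) _ L,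
      ← Matrix.mulVec_mulVec (x s) _ L, ← Matrix.mulVec_mulVec _ (tildeB B C d), h1, Pi.add_apply, Pi.add_apply]
  have hLint : ∀ j, IntervalIntegrable (fun s => (L * closedLoop A B C k s).mulVec (x s) j)
      volume a T := by
    intro j
    have hint := intervalIntegrable_closedLoop_mulVec (A := A) (B := B) (C := C) haT hk hxc
    let L' : (Fin n → ℝ) →L[ℝ] ℝ :=
      ((LinearMap.proj j).comp L.mulVecLin).toContinuousLinearMap
    have h1 : ∀ s, (L * closedLoop A B C k s).mulVec (x s) j =
        L' ((closedLoop A B C k s).mulVec (x s)) := fun s => by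
      rw [← Matrix.mulVec_mulVec]
      rfl
    simp_rw [h1]
    exact ⟨L'.integrable_comp hint.1, L'.integrable_comp hint.2⟩
  have hpres : ∀ {p : ℕ} (W : Matrix (Fin p) (Fin n) ℝ) (i : Fin p) {t : ℝ}, t ∈ Icc a T →
      W.mulVec (x t) i = W.mulVec (x a) i +
        ∫ s in a..t, (W * closedLoop A B C k s).mulVec (x s) i := fun W i _ ht =>
    hx.mulVec_eq hk W i ht
  refine sum_abs_add_mul_sum_abs_le (A₁₁ := blockA11 A B C M) (A₁₂ := tildeA12 A B C M d)
    (A₂₁ := tildeA21 A C M d) (A₂₂ := tildeA22 A B C d) (Bt := tildeB B C d) (β := β)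
    (k := fun s l => k l s) (z := fun s => N.mulVec (x s)) (y := fun s => L.mulVec (x s))
    hμ hdata.exp_le haT hρ hρU hρy (hmulc N) (hmulc L) ?_ ?_ ?_
  · intro s hs i
    have hc : ContinuousOn (fun s => (N * closedLoop A B C k s).mulVec (x s) i) (Icc a T) := by
      simp_rw [hNx]
      exact continuousOn_pi.1 (hmulc _) i
    have h1 := (hc.hasDerivAt_primitive hs).const_add (N.mulVec (x a) i)
    rw [hNx'] at h1
    refine h1.congr_of_eventuallyEq ?_
    filter_upwards [Icc_mem_nhds hs.1 hs.2] with t ht using hpres N i ht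
  · intro j
    have h1 : AbsolutelyContinuousOnInterval (fun t => L.mulVec (x a) j +
        ∫ s in a..t, (L * closedLoop A B C k s).mulVec (x s) j) a T :=
      (absolutelyContinuousOnInterval_const _ _ _).fun_add
        ((hLint j).absolutelyContinuousOnInterval_intervalIntegral left_mem_uIcc)
    rw [absolutelyContinuousOnInterval_iff] at h1 ⊢
    intro ε hε
    obtain ⟨δ, hδ, h2⟩ := h1 ε hε
    refine ⟨δ, hδ, fun E hE hlen => ?_⟩
    refine lt_of_eq_of_lt (Finset.sum_congr rfl fun i hi => ?_) (h2 E hE hlen)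
    have h3 := hE.1 i hi
    rw [uIcc_of_le haT] at h3
    rw [hpres L j h3.1, hpres L j h3.2]
  · have hae : ∀ᵐ s, ∀ j, s ∈ uIcc a T → ∀ c ∈ uIcc a T,
        HasDerivAt (fun t => ∫ r in c..t, (L * closedLoop A B C k r).mulVec (x r) j)
          ((L * closedLoop A B C k s).mulVec (x s) j) s :=
      ae_all_iff.2 fun j => (hLint j).ae_hasDerivAt_integral
    filter_upwards [hae] with s hs hsm j
    have hs' : s ∈ uIcc a T := by
      rw [uIcc_of_le haT]
      exact Ioo_subset_Icc_self hsm
    have h1 := (hs j hs' a left_mem_uIcc).const_add (L.mulVec (x a) j)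
    rw [hLx] at h1
    refine h1.congr_of_eventuallyEq ?_
    filter_upwards [Icc_mem_nhds hsm.1 hsm.2] with t ht using hpres L j ht

/-- Gains above the thresholds leave a uniform margin in every column of the output equation. -/
theorem exists_uniform_margin {K β : ℝ} (hdata : IsBoundData A B C M d K β)
    (hH : IsHurwitz (C * B)) {kbar : Fin m → ℝ}
    (hkbar : ∀ j, 0 < kbar j ∧ gainThreshold A B C M d K β j < kbar j) :
    ∃ ε : ℝ, 0 < ε ∧ ∀ j, ∀ κ : ℝ, kbar j ≤ κ →
      (tildeA22 A B C d j j + tildeB B C d j j * κ) +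
        (∑ i ∈ Finset.univ.erase j, |tildeA22 A B C d i j| +
          |κ| * ∑ i ∈ Finset.univ.erase j, |tildeB B C d i j|) +
        gammaBound A B C M d K β + ε ≤ 0 := by
  have hneg : ∀ j, 0 < -(tildeB B C d j j + ∑ i ∈ Finset.univ.erase j, |tildeB B C d i j|) := by
    intro j
    have h1 := (hH.tildeB hdata.d_pos).diag_neg_of_isColDiagDominant hdata.dominant j
    have h2 := hdata.dominant j
    rw [abs_of_neg h1] at h2
    linarith
  have hev : ∀ᶠ ε : ℝ in 𝓝[>] 0, ∀ j,
      ∑ i ∈ Finset.univ.erase j, |tildeA22 A B C d i j| + tildeA22 A B C d j j +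
        gammaBound A B C M d K β + ε ≤
      kbar j * -(tildeB B C d j j + ∑ i ∈ Finset.univ.erase j, |tildeB B C d i j|) := by
    rw [eventually_all]
    intro j
    have h1 := (div_lt_iff₀ (hneg j)).1 (hkbar j).2
    filter_upwards [nhdsWithin_le_nhds (gt_mem_nhds (sub_pos.2 h1))] with ε hε
    linarith
  obtain ⟨ε, hε, hε0⟩ := (hev.and self_mem_nhdsWithin).exists
  refine ⟨ε, hε0, fun j κ hκ => ?_⟩
  have h1 := mul_le_mul_of_nonneg_right hκ (hneg j).le
  have h2 := hε j
  rw [abs_of_pos ((hkbar j).1.trans_le hκ)]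
  linarith

/-- All gain bounds above the explicit thresholds are sufficient. -/
theorem IsBoundData.gainsSuffice (hmn : m ≤ n) (hCB : IsUnit (C * B).det)
    (hH : IsHurwitz (C * B)) {K β : ℝ} (hdata : IsBoundData A B C M d K β) {kbar : Fin m → ℝ}
    (hkbar : ∀ j, 0 < kbar j ∧ gainThreshold A B C M d K β j < kbar j) :
    GainsSuffice A B C kbar := by
  obtain ⟨ε, hε, hmargin⟩ := exists_uniform_margin hdata hH hkbar
  intro k hk tbar htbar hkt
  have hK := hdata.M₁₁_pos
  have hβ := hdata.β₁₁_pos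
  set a12 := colSumNorm (tildeA12 A B C M d) with ha12
  set a21 := colSumNorm (tildeA21 A C M d) with ha21
  have ha12' : 0 ≤ a12 := colSumNorm_nonneg _
  have ha21' : 0 ≤ a21 := colSumNorm_nonneg _
  -- `a21 / β` is the critical weight; half of the margin `ε` pays for the excess `δ` over it,
  -- the other half for the decay rate
  obtain ⟨δ, hδ, hδε⟩ : ∃ δ : ℝ, 0 < δ ∧ δ * (K * a12) ≤ ε / 2 := by
    refine ⟨ε / (2 * (K * a12 + 1)), by positivity, ?_⟩
    have h1 : 0 ≤ K * a12 := by positivity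
    rw [div_mul_eq_mul_div, div_le_div_iff₀ (by positivity) (by norm_num)]
    nlinarith
  set μ := a21 / β + δ with hμdef
  have hμ : 0 < μ := by positivity
  have hμβ : μ * β = a21 + δ * β := by
    rw [hμdef]
    field_simp
  have hμγ : μ * (K * a12) ≤ gammaBound A B C M d K β + ε / 2 := by
    have h1 : μ * (K * a12) = gammaBound A B C M d K β + δ * (K * a12) := by
      rw [hμdef, gammaBound]
      ring
    linarith
  set η := min (ε / 2) (δ * β / μ) with hη
  have hη0 : 0 < η := lt_min (by positivity) (by positivity)
  have hηε : η ≤ ε / 2 := min_le_left _ _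
  have hημ : μ * η ≤ δ * β := by
    have h1 : η ≤ δ * β / μ := min_le_right _ _
    rw [le_div_iff₀ hμ] at h1
    linarith
  -- `H` bounds the growth of the Lyapunov function before `tbar`
  set H : ℝ → ℝ := fun s => ∑ j, ((|tildeA22 A B C d j j| + |tildeB B C d j j| * |k j s|) +
      (∑ i ∈ Finset.univ.erase j, |tildeA22 A B C d i j| +
        |k j s| * ∑ i ∈ Finset.univ.erase j, |tildeB B C d i j|)) + (μ * (K * a12) + η) with hHdef
  have hterm : ∀ s j, 0 ≤ (|tildeA22 A B C d j j| + |tildeB B C d j j| * |k j s|) +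
      (∑ i ∈ Finset.univ.erase j, |tildeA22 A B C d i j| +
        |k j s| * ∑ i ∈ Finset.univ.erase j, |tildeB B C d i j|) := by
    intro s j
    positivity
  have hH0 : ∀ s, 0 ≤ H s := by
    intro s
    have h1 : 0 ≤ μ * (K * a12) + η := by positivity
    exact add_nonneg (Finset.sum_nonneg fun j _ => hterm s j) h1
  set ρ : ℝ → ℝ := fun s => -η + (Iio tbar).indicator H s with hρdef
  have hkI : ∀ {a T : ℝ}, 0 ≤ a → ∀ i, IntegrableOn (k i) (Icc a T) := fun ha i =>
    (hk i).integrableOn_compact_subset (fun s hs => ha.trans hs.1) isCompact_Icc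
  have hHI : ∀ {a T : ℝ}, 0 ≤ a → IntegrableOn H (Icc a T) := by
    intro a T ha
    have hc : ∀ c : ℝ, IntegrableOn (fun _ : ℝ => c) (Icc a T) := fun c =>
      continuousOn_const.integrableOn_Icc
    refine Integrable.add (integrable_finsetSum _ fun j _ => ?_) (hc _)
    have hkj := (hkI (T := T) ha j).abs
    exact ((hc _).add (hkj.const_mul _)).add ((hc _).add (hkj.mul_const _))
  set J := ∫ s in Icc 0 tbar, H s with hJ
  set L := Matrix.diagonal d * C with hL
  set N := matN B C M with hN
  set Q := B * (C * B)⁻¹ * (Matrix.diagonal d)⁻¹ with hQ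
  set c₁ := colSumNorm M / μ + colSumNorm Q with hc₁
  set c₂ := colSumNorm L + μ * (K * colSumNorm N) with hc₂
  have hc₁' : 0 ≤ c₁ := add_nonneg (div_nonneg (colSumNorm_nonneg _) hμ.le) (colSumNorm_nonneg _)
  have hc₂' : 0 ≤ c₂ := add_nonneg (colSumNorm_nonneg _)
    (mul_nonneg hμ.le (mul_nonneg hK.le (colSumNorm_nonneg _)))
  -- the summand `1` keeps the constant positive when `n = 0`
  refine ⟨c₁ * (Real.exp J * (c₂ * n)) + 1, η, by positivity, hη0, fun a ha x hx T haT => ?_⟩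
  have hind : IntegrableOn ((Iio tbar).indicator H) (Icc a T) :=
    (hHI ha).indicator measurableSet_Iio
  have hindI : IntervalIntegrable ((Iio tbar).indicator H) volume a T := by
    rw [intervalIntegrable_iff_integrableOn_Icc_of_le haT]
    exact hind
  have hρint : ∫ s in a..T, ρ s ≤ J - η * (T - a) := by
    have h1 : ∫ s in a..T, (Iio tbar).indicator H s ≤ J := by
      rw [intervalIntegral.integral_of_le haT, setIntegral_indicator measurableSet_Iio]
      refine setIntegral_mono_set (hHI le_rfl) (Eventually.of_forall hH0) ?_
      refine LE.le.eventuallyLE fun s hs => ?_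
      exact ⟨ha.trans hs.1.1.le, (mem_Iio.1 hs.2).le⟩
    rw [hρdef, intervalIntegral.integral_add intervalIntegrable_const hindI,
      intervalIntegral.integral_const, smul_eq_mul]
    linarith
  have hest := hx.sum_abs_output_add_le hmn hdata hCB hμ.le (ρ := ρ) haT
    (fun i => (intervalIntegrable_iff_integrableOn_Icc_of_le haT).2 (hkI ha i))
    (intervalIntegrable_const.add hindI) (fun s _ => ?_) (fun s _ j => ?_)
  · rw [← hL, ← hN] at hest
    set Z := ∑ i, |N.mulVec (x T) i| with hZ
    set Y := ∑ j, |L.mulVec (x T) j| with hY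
    have hZ0 : 0 ≤ Z := Finset.sum_nonneg fun _ _ => abs_nonneg _
    have hY0 : 0 ≤ Y := Finset.sum_nonneg fun _ _ => abs_nonneg _
    have hxT : ∑ i, |x T i| ≤ c₁ * (Y + μ * Z) := by
      have h1 : x T = M.mulVec (N.mulVec (x T)) + Q.mulVec (L.mulVec (x T)) := by
        rw [Matrix.mulVec_mulVec, Matrix.mulVec_mulVec, ← Matrix.add_mulVec,
          mul_matN_add_scaled hmn hdata.rank_eq hdata.mul_eq_zero hCB hdata.d_pos,
          Matrix.one_mulVec]
      have h2 : ∑ i, |x T i| ≤ colSumNorm M * Z + colSumNorm Q * Y := by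
        calc ∑ i, |x T i|
            ≤ ∑ i, (|M.mulVec (N.mulVec (x T)) i| + |Q.mulVec (L.mulVec (x T)) i|) := by
              refine Finset.sum_le_sum fun i _ => ?_
              conv_lhs => rw [h1]
              exact abs_add_le _ _
          _ ≤ _ := by
              rw [Finset.sum_add_distrib]
              exact add_le_add (sum_abs_mulVec_le _ _) (sum_abs_mulVec_le _ _)
      have h3 : c₁ * (Y + μ * Z) = colSumNorm M * Z + colSumNorm Q * Y +
          (colSumNorm M / μ * Y + colSumNorm Q * (μ * Z)) := by
        rw [hc₁]
        field_simp
        ring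
      have h4 : 0 ≤ colSumNorm M / μ * Y + colSumNorm Q * (μ * Z) := by
        have := colSumNorm_nonneg M
        have := colSumNorm_nonneg Q
        positivity
      linarith
    have hxa : ∑ j, |L.mulVec (x a) j| + μ * (K * ∑ i, |N.mulVec (x a) i|) ≤
        c₂ * (n * ‖WithLp.toLp 2 (x a)‖) := by
      have h1 := sum_abs_mulVec_le L (x a)
      have h2 := mul_le_mul_of_nonneg_left (mul_le_mul_of_nonneg_left
        (sum_abs_mulVec_le N (x a)) hK.le) hμ.le
      have h3 := mul_le_mul_of_nonneg_left (sum_abs_le_mul_norm_toLp (x a)) hc₂'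
      refine le_trans ?_ h3
      rw [hc₂]
      linarith
    have hexp : Real.exp (∫ s in a..T, ρ s) ≤ Real.exp J * Real.exp (-η * (T - a)) := by
      rw [← Real.exp_add]
      exact Real.exp_le_exp.2 (by linarith)
    calc ‖WithLp.toLp 2 (x T)‖ ≤ ∑ i, |x T i| := norm_toLp_le_sum_abs _
      _ ≤ c₁ * (Y + μ * Z) := hxT
      _ ≤ c₁ * (Real.exp (∫ s in a..T, ρ s) *
            (∑ j, |L.mulVec (x a) j| + μ * (K * ∑ i, |N.mulVec (x a) i|))) :=
          mul_le_mul_of_nonneg_left hest hc₁'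
      _ ≤ c₁ * (Real.exp J * Real.exp (-η * (T - a)) *
            (c₂ * (n * ‖WithLp.toLp 2 (x a)‖))) := by gcongr
      _ = c₁ * (Real.exp J * (c₂ * n)) * Real.exp (-η * (T - a)) *
            ‖WithLp.toLp 2 (x a)‖ := by ring
      _ ≤ _ := by
          gcongr
          linarith
  · have h1 : 0 ≤ (Iio tbar).indicator H s := indicator_nonneg (fun s _ => hH0 s) s
    have h2 := mul_nonneg hμ.le h1
    have h3 : μ * (β + ρ s) = μ * β - μ * η + μ * (Iio tbar).indicator H s := by
      rw [hρdef]
      ring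
    rw [h3]
    linarith
  · by_cases hs : s < tbar
    · have h1 : ρ s = -η + H s := by
        rw [hρdef]
        simp [hs]
      have h2 := Finset.single_le_sum (fun j _ => hterm s j) (Finset.mem_univ j)
      have h3 : tildeB B C d j j * k j s ≤ |tildeB B C d j j| * |k j s| := by
        rw [← abs_mul]
        exact le_abs_self _
      have h4 := le_abs_self (tildeA22 A B C d j j)
      rw [h1, hHdef]
      simp only at h2 ⊢
      linarith
    · have h1 : ρ s = -η := by
        rw [hρdef]
        simp [hs]
      have h2 := hmargin j (k j s) (hkt j s (not_lt.1 hs))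
      rw [h1]
      linarith

end ClosedLoop

theorem mainTheorem1 {n m : ℕ} (A : Matrix (Fin n) (Fin n) ℝ)
    (B : Matrix (Fin n) (Fin m) ℝ) (C : Matrix (Fin m) (Fin n) ℝ)
    (hB : B.rank = m) (hC : C.rank = m) (hCB : (C * B).rank = m)
    (hmin : IsMinimumPhase A B C)
    (hHurwitz : IsHurwitz (C * B)) (hHmatrix : IsHMatrix (C * B)) :
    -- positive gain bounds exist
    (∃ kbar : Fin m → ℝ, (∀ i, 0 < kbar i) ∧ GainsSuffice A B C kbar) ∧
    -- the explicit bound: data for it exist, and all such data yield sufficient gains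
    (∃ (M : Matrix (Fin n) (Fin (n - m)) ℝ) (d : Fin m → ℝ) (M₁₁ β₁₁ : ℝ),
      IsBoundData A B C M d M₁₁ β₁₁) ∧
    (∀ (M : Matrix (Fin n) (Fin (n - m)) ℝ) (d : Fin m → ℝ) (M₁₁ β₁₁ : ℝ),
      IsBoundData A B C M d M₁₁ β₁₁ →
      ∀ kbar : Fin m → ℝ,
        (∀ j, 0 < kbar j ∧ gainThreshold A B C M d M₁₁ β₁₁ j < kbar j) →
        GainsSuffice A B C kbar) := by
  have hmn : m ≤ n := hC ▸ C.rank_le_width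
  have hdata := exists_isBoundData hC hCB hmin hHmatrix
  have hsuff : ∀ (M : Matrix (Fin n) (Fin (n - m)) ℝ) (d : Fin m → ℝ) (M₁₁ β₁₁ : ℝ),
      IsBoundData A B C M d M₁₁ β₁₁ → ∀ kbar : Fin m → ℝ,
        (∀ j, 0 < kbar j ∧ gainThreshold A B C M d M₁₁ β₁₁ j < kbar j) →
        GainsSuffice A B C kbar := fun M d M₁₁ β₁₁ h kbar hkbar =>
    h.gainsSuffice hmn (Matrix.isUnit_det_of_rank_eq hCB) hHurwitz hkbar
  refine ⟨?_, hdata, hsuff⟩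
  obtain ⟨M, d, M₁₁, β₁₁, h⟩ := hdata
  have hk : ∀ j, 0 < max 1 (gainThreshold A B C M d M₁₁ β₁₁ j + 1) ∧
      gainThreshold A B C M d M₁₁ β₁₁ j < max 1 (gainThreshold A B C M d M₁₁ β₁₁ j + 1) := fun j =>
    ⟨lt_max_of_lt_left one_pos, lt_max_of_lt_right (lt_add_one _)⟩
  exact ⟨_, fun j => (hk j).1, hsuff M d M₁₁ β₁₁ h _ hk⟩
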